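/- Let $n\ge 1$ and let $A^2(\mathbb C^n,e^{-|z|^2})$ be the Fock space of entire functions $f$ with $\|f\|^2=\int_{\mathbb C^n}|f|^2e^{-|z|^2}\,d\lambda<\infty$. For $0\le p\le n$ let $A^2_{(p,0)}=A^2_{(p,0)}(\mathbb C^n,e^{-|z|^2})$ be the Hilbert space of forms $u=\sum'_{|J|=p}u_J\,dz_J$ (sum over increasing multiindices) with coefficients in $A^2(\mathbb C^n,e^{-|z|^2})$ and $\|u\|^2=\sum'_{|J|=p}\|u_J\|^2$ (and $A^2_{(n+1,0)}=0$). Let $\partial u=\sum'_{|J|=p}\sum_{k=1}^n\frac{\partial u_J}{\partial z_k}\,dz_k\wedge dz_J$ with domain $\mathrm{dom}(\partial)=\{u\in A^2_{(p,0)}:\partial u\in A^2_{(p+1,0)}\}$, let $\partial^*$ be its Hilbert space adjoint, and let $\tilde\Box_p=\partial^*\partial+\partial\partial^*$ on $A^2_{(p,0)}$ with domain $\{u\in\mathrm{dom}(\partial)\cap\mathrm{dom}(\partial^*):\partial u\in\mathrm{dom}(\partial^*),\ \partial^*u\in\mathrm{dom}(\partial)\}$. Then for all $1\le p\le n$ the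 operator $\tilde\Box_p:\mathrm{dom}(\tilde\Box_p)\to A^2_{(p,0)}$ is bijective with bounded inverse, and this inverse, the $\partial$-Neumann operator $\tilde N:A^2_{(p,0)}\to A^2_{(p,0)}$, is a compact operator. Moreover, the following holds. (a) If $u\in\mathrm{dom}(\partial)\cap\mathrm{dom}(\partial^*)$, then all $\frac{\partial u_J}{\partial z_k}$ belong to $A^2(\mathbb C^n,e^{-|z|^2})$, and the graph norm $\|u\|_Q=(\|\partial u\|^2+\|\partial^*u\|^2)^{1/2}$ satisfies $$\|u\|_Q^2=\sum_{|J|=p}{}^{'}\sum_{k=1}^n\Big\|\frac{\partial u_J}{\partial z_k}\Big\|^2+p\,\|u\|^2 .$$ (b) The embedding $\iota:\mathrm{dom}(\partial)\cap\mathrm{dom}(\partial^*)\to A^2_{(p,0)}$, $\iota(u)=u$, where the domain carries the inner product $(u,v)_Q=(\partial u,\partial v)+(\partial^*u,\partial^*v)$, is compact. (c) $\iota$ has a bounded adjoint $\iota^*:A^2_{(p,0)}\to\mathrm{dom}(\partial)\cap\mathrm{dom}(\partial^*)$, that is, $(\iota^*u,v)_Q=(u,\iota v)$ for all $u,v$,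 and $\tilde N=\iota\circ\iota^*$. -/

import Mathlib

open scoped ComplexConjugate

noncomputable section

/-! ### The Fock space -/

namespace FockSpace

/-- The Gaussian weight `e^{-|z|^2}`, where `|z|^2 = |z_1|^2 + ... + |z_n|^2`. -/
def weight {n : ℕ} (z : Fin n → ℂ) : ℝ := Real.exp (-∑ i, ‖z i‖ ^ 2)

/-- Membership in the Fock space: `f` is entire and `∫ |f|^2 e^{-|z|^2} dλ < ∞`. -/
def Mem {n : ℕ} (f : (Fin n → ℂ) → ℂ) : Prop :=
  Differentiable ℂ f ∧ MeasureTheory.Integrable (fun z => ‖f z‖ ^ 2 * weight z)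

theorem weight_pos {n : ℕ} (z : Fin n → ℂ) : 0 < weight z := Real.exp_pos _

theorem continuous_weight {n : ℕ} : Continuous (weight (n := n)) := by
  unfold weight; fun_prop

theorem integrable_mul {n : ℕ} {f g : (Fin n → ℂ) → ℂ} (hf : Mem f) (hg : Mem g) :
    MeasureTheory.Integrable (fun z => conj (f z) * g z * (weight z : ℂ)) := by
  have hw := continuous_weight (n := n)
  have hfc := hf.1.continuous
  have hgc := hg.1.continuous
  refine (hf.2.add hg.2).mono' ?_ (Filter.Eventually.of_forall fun z => ?_)
  · have : Continuous fun z => conj (f z) * g z * (weight z : ℂ) :=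
      ((Complex.continuous_conj.comp hfc).mul hgc).mul (Complex.continuous_ofReal.comp hw)
    exact this.aestronglyMeasurable
  · have h0 := (weight_pos z).le
    simp only [norm_mul, RCLike.norm_conj, Complex.norm_real, Real.norm_eq_abs,
      abs_of_nonneg h0, Pi.add_apply]
    rw [← add_mul]
    refine mul_le_mul_of_nonneg_right ?_ h0
    nlinarith [sq_nonneg (‖f z‖ - ‖g z‖), sq_nonneg ‖f z‖, sq_nonneg ‖g z‖]

theorem Mem.add {n : ℕ} {f g : (Fin n → ℂ) → ℂ} (hf : Mem f) (hg : Mem g) : Mem (f + g) := by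
  refine ⟨hf.1.add hg.1, ?_⟩
  have hw := continuous_weight (n := n)
  have hfc := hf.1.continuous
  have hgc := hg.1.continuous
  refine ((hf.2.const_mul 2).add (hg.2.const_mul 2)).mono' ?_
    (Filter.Eventually.of_forall fun z => ?_)
  · exact (((hfc.add hgc).norm.pow 2).mul hw).aestronglyMeasurable
  · have h0 := (weight_pos z).le
    have h1 := norm_add_le (f z) (g z)
    have h2 := norm_nonneg (f z + g z)
    rw [Real.norm_of_nonneg (by positivity)]
    simp only [Pi.add_apply]
    rw [← mul_assoc, ← mul_assoc, ← add_mul]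
    refine mul_le_mul_of_nonneg_right ?_ h0
    nlinarith [sq_nonneg (‖f z‖ - ‖g z‖)]

theorem Mem.smul {n : ℕ} {f : (Fin n → ℂ) → ℂ} (c : ℂ) (hf : Mem f) : Mem (c • f) := by
  refine ⟨hf.1.const_smul c, ?_⟩
  have := hf.2.const_mul (‖c‖ ^ 2)
  refine this.congr (Filter.Eventually.of_forall fun z => ?_)
  simp [mul_pow, mul_assoc]

theorem mem_zero {n : ℕ} : Mem (0 : (Fin n → ℂ) → ℂ) :=
  ⟨differentiable_const 0, by simp⟩

end FockSpace

/-- The Fock space `A²(ℂⁿ, e^{-|z|²})` as a linear subspace of the space of all functions. -/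
def fockSubmodule (n : ℕ) : Submodule ℂ ((Fin n → ℂ) → ℂ) where
  carrier := {f | FockSpace.Mem f}
  add_mem' := FockSpace.Mem.add
  zero_mem' := FockSpace.mem_zero
  smul_mem' := fun c _ hf => FockSpace.Mem.smul c hf

/-- The Fock space `A²(ℂⁿ, e^{-|z|²})` as a type. (It does not inherit the topology of pointwise
convergence; its topology is that of the norm given below.) -/
def Fock (n : ℕ) : Type := ↥(fockSubmodule n)

namespace Fock

variable {n : ℕ}

instance : AddCommGroup (Fock n) := inferInstanceAs (AddCommGroup ↥(fockSubmodule n))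

instance : Module ℂ (Fock n) := inferInstanceAs (Module ℂ ↥(fockSubmodule n))

/-- The entire function underlying an element of the Fock space. -/
def toFun (f : Fock n) : (Fin n → ℂ) → ℂ := f.1

instance : CoeFun (Fock n) (fun _ => (Fin n → ℂ) → ℂ) := ⟨toFun⟩

/-- An entire function with finite norm, as an element of the Fock space. -/
def mk (f : (Fin n → ℂ) → ℂ) (hf : FockSpace.Mem f) : Fock n := ⟨f, hf⟩

theorem mem (f : Fock n) : FockSpace.Mem (f : (Fin n → ℂ) → ℂ) := f.2

theorem ext {f g : Fock n} (h : ∀ z, f z = g z) : f = g := Subtype.ext (funext h)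

@[simp] theorem mk_apply (f : (Fin n → ℂ) → ℂ) (hf : FockSpace.Mem f) (z : Fin n → ℂ) :
    mk f hf z = f z := rfl

@[simp] theorem add_apply (f g : Fock n) (z : Fin n → ℂ) : (f + g) z = f z + g z := rfl

@[simp] theorem smul_apply (c : ℂ) (f : Fock n) (z : Fin n → ℂ) : (c • f) z = c * f z := rfl

@[simp] theorem zero_apply (z : Fin n → ℂ) : (0 : Fock n) z = 0 := rfl

/-- The inner product of the Fock space is `∫ f(z) \overline{g(z)} e^{-|z|²} dλ(z)`; with the
convention of conjugate linearity in the first slot it reads as follows. -/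
instance innerCore : InnerProductSpace.Core ℂ (Fock n) where
  inner f g := ∫ z, conj (f z) * g z * (FockSpace.weight z : ℂ)
  conj_inner_symm f g := by
    rw [← integral_conj]
    congr 1
    ext z
    simp only [map_mul, Complex.conj_conj, Complex.conj_ofReal]
    ring
  re_inner_nonneg f := by
    have h : (fun z => conj (f z) * f z * (FockSpace.weight z : ℂ))
        = fun z => ((‖f z‖ ^ 2 * FockSpace.weight z : ℝ) : ℂ) := by
      ext z
      rw [Complex.conj_mul']
      push_cast
      ring
    rw [h, integral_complex_ofReal]
    exact MeasureTheory.integral_nonneg fun z =>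
      mul_nonneg (by positivity) (FockSpace.weight_pos z).le
  add_left f g h := by
    rw [← MeasureTheory.integral_add (FockSpace.integrable_mul f.mem h.mem)
      (FockSpace.integrable_mul g.mem h.mem)]
    congr 1
    ext z
    simp
    ring
  smul_left f g c := by
    rw [← MeasureTheory.integral_const_mul]
    congr 1
    ext z
    simp
    ring
  definite f hf := by
    have h : (fun z => conj (f z) * f z * (FockSpace.weight z : ℂ))
        = fun z => ((‖f z‖ ^ 2 * FockSpace.weight z : ℝ) : ℂ) := by
      ext z
      rw [Complex.conj_mul']
      push_cast
      ring
    rw [h, integral_complex_ofReal, Complex.ofReal_eq_zero,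
      MeasureTheory.integral_eq_zero_iff_of_nonneg
        (fun z => mul_nonneg (by positivity) (FockSpace.weight_pos z).le) f.mem.2] at hf
    have hc : Continuous fun z => ‖f z‖ ^ 2 * FockSpace.weight z :=
      (f.mem.1.continuous.norm.pow 2).mul FockSpace.continuous_weight
    have h0 := (hc.ae_eq_iff_eq MeasureTheory.volume continuous_zero).1 hf
    refine Fock.ext fun z => ?_
    have h1 := congrFun h0 z
    simpa [(FockSpace.weight_pos z).ne'] using h1

instance : NormedAddCommGroup (Fock n) := (innerCore (n := n)).toNormedAddCommGroup

instance : InnerProductSpace ℂ (Fock n) := InnerProductSpace.ofCore (innerCore (n := n)).toCore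

end Fock

/-! ### `(p,0)`-forms and the operator `∂` -/

/-- Increasing multiindices `J = (j_1 < ... < j_p)`, encoded as the sets `{j_1, ..., j_p}`. -/
abbrev MultiIdx (n p : ℕ) : Type := {J : Finset (Fin n) // J.card = p}

/-- The space `A²_{(p,0)}(ℂⁿ, e^{-|z|²})` of `(p,0)`-forms `f = ∑'_{|J|=p} f_J dz_J` with
coefficients in the Fock space, with the inner product `(f,g) = ∑'_J (f_J, g_J)`. -/
abbrev FockForm (n p : ℕ) : Type := PiLp 2 (fun _ : MultiIdx n p => Fock n)

/-- The complex partial derivative `∂f/∂z_k`. -/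
def dz {n : ℕ} (k : Fin n) (f : (Fin n → ℂ) → ℂ) (z : Fin n → ℂ) : ℂ :=
  fderiv ℂ f z (Pi.single k 1)

/-- `J = K \ {k}`, for `k ∈ K`. -/
def MultiIdx.erase {n p : ℕ} (K : MultiIdx n (p + 1)) (k : {k // k ∈ K.1}) : MultiIdx n p :=
  ⟨K.1.erase k.1, by rw [Finset.card_erase_of_mem k.2, K.2, Nat.add_sub_cancel]⟩

/-- The coefficient of `dz_K` in `∂u = ∑'_J ∑_k ∂u_J/∂z_k dz_k ∧ dz_J`. Only the pairs `(k, J)`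
with `k ∈ K` and `J = K \ {k}` contribute, and then `dz_k ∧ dz_J = (-1)^s dz_K`, where `s` is the
number of elements of `J` below `k`. -/
def delCoeff {n p : ℕ} (u : FockForm n p) (K : MultiIdx n (p + 1)) (z : Fin n → ℂ) : ℂ :=
  ∑ k : {k // k ∈ K.1},
    (-1) ^ ((K.erase k).1.filter (· < k.1)).card * dz k.1 (u (K.erase k)) z

theorem delCoeff_add {n p : ℕ} (u v : FockForm n p) (K : MultiIdx n (p + 1)) :
    delCoeff (u + v) K = delCoeff u K + delCoeff v K := by
  ext z
  simp only [delCoeff, Pi.add_apply, ← Finset.sum_add_distrib]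
  refine Finset.sum_congr rfl fun k _ => ?_
  rw [← mul_add]
  congr 1
  have h : ((u + v) (K.erase k)).toFun = (u (K.erase k)).toFun + (v (K.erase k)).toFun := rfl
  rw [dz, h, fderiv_add ((u (K.erase k)).mem.1 z) ((v (K.erase k)).mem.1 z)]
  rfl

theorem delCoeff_smul {n p : ℕ} (c : ℂ) (u : FockForm n p) (K : MultiIdx n (p + 1)) :
    delCoeff (c • u) K = c • delCoeff u K := by
  ext z
  simp only [delCoeff, Pi.smul_apply, smul_eq_mul, Finset.mul_sum]
  refine Finset.sum_congr rfl fun k _ => ?_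
  have h : ((c • u) (K.erase k)).toFun = c • (u (K.erase k)).toFun := rfl
  rw [dz, h, fderiv_const_smul ((u (K.erase k)).mem.1 z)]
  simp only [dz, smul_apply, smul_eq_mul]
  ring

/-- The operator `∂` from `A²_{(p,0)}` to `A²_{(p+1,0)}`, with the maximal domain
`dom ∂ = {u ∈ A²_{(p,0)} : ∂u ∈ A²_{(p+1,0)}}`. -/
def del (n p : ℕ) : FockForm n p →ₗ.[ℂ] FockForm n (p + 1) where
  domain :=
    { carrier := {u | ∀ K, FockSpace.Mem (delCoeff u K)}
      add_mem' := fun {u v} hu hv K => by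
        rw [delCoeff_add]; exact (hu K).add (hv K)
      zero_mem' := fun K => by
        have h := delCoeff_smul (0 : ℂ) (0 : FockForm n p) K
        rw [zero_smul, zero_smul] at h
        rw [h]; exact FockSpace.mem_zero
      smul_mem' := fun c u hu K => by
        rw [delCoeff_smul]; exact (hu K).smul c }
  toFun :=
    { toFun := fun u => WithLp.toLp 2 fun K => Fock.mk (delCoeff u.1 K) (u.2 K)
      map_add' := fun u v => by
        ext K : 1
        exact Subtype.ext (delCoeff_add u.1 v.1 K)
      map_smul' := fun c u => by
        ext K : 1
        exact Subtype.ext (delCoeff_smul c u.1 K) }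

/-- The operator `∂` from `A²_{(p-1,0)}` to `A²_{(p,0)}`; for `p = 0` it is the zero operator. -/
def delPrev (n : ℕ) : (p : ℕ) → FockForm n (p - 1) →ₗ.[ℂ] FockForm n p
  | 0 => 0
  | p + 1 => del n p

/-! ### Unbounded operators: adjoints, compositions and the complex Laplacian -/

namespace HilbertComplex

variable {E F G : Type*}
  [NormedAddCommGroup E] [InnerProductSpace ℂ E]
  [NormedAddCommGroup F] [InnerProductSpace ℂ F]
  [NormedAddCommGroup G] [InnerProductSpace ℂ G]

/-- The Hilbert space adjoint `T*` of a densely defined operator `T`: `y ∈ dom T*` and `T* y = w`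
if and only if `(T x, y) = (x, w)` for all `x ∈ dom T`. -/
def adj (T : E →ₗ.[ℂ] F) : F →ₗ.[ℂ] E := T.graph.adjoint.toLinearPMap

/-- The composition `g ∘ f` with its natural domain `{x ∈ dom f : f x ∈ dom g}`. -/
def comp (g : F →ₗ.[ℂ] G) (f : E →ₗ.[ℂ] F) : E →ₗ.[ℂ] G where
  domain :=
    { carrier := {x | ∃ h : x ∈ f.domain, f ⟨x, h⟩ ∈ g.domain}
      add_mem' := by
        rintro x y ⟨hx, hx'⟩ ⟨hy, hy'⟩
        refine ⟨f.domain.add_mem hx hy, ?_⟩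
        have h : f ⟨x + y, f.domain.add_mem hx hy⟩ = f ⟨x, hx⟩ + f ⟨y, hy⟩ :=
          f.map_add ⟨x, hx⟩ ⟨y, hy⟩
        rw [h]; exact g.domain.add_mem hx' hy'
      zero_mem' := by
        refine ⟨f.domain.zero_mem, ?_⟩
        have h : f ⟨0, f.domain.zero_mem⟩ = 0 := f.map_zero
        rw [h]; exact g.domain.zero_mem
      smul_mem' := by
        rintro c x ⟨hx, hx'⟩
        refine ⟨f.domain.smul_mem c hx, ?_⟩
        have h : f ⟨c • x, f.domain.smul_mem c hx⟩ = c • f ⟨x, hx⟩ := f.map_smul c ⟨x, hx⟩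
        rw [h]; exact g.domain.smul_mem c hx' }
  toFun :=
    { toFun := fun x => g ⟨f ⟨x.1, x.2.1⟩, x.2.2⟩
      map_add' := by
        intro x y
        rw [← g.map_add]
        congr 1
        exact Subtype.ext (f.map_add ⟨x.1, x.2.1⟩ ⟨y.1, y.2.1⟩)
      map_smul' := by
        intro c x
        rw [RingHom.id_apply, ← g.map_smul]
        congr 1
        exact Subtype.ext (f.map_smul c ⟨x.1, x.2.1⟩) }

/-- For `E --S--> F --T--> G`, the Laplacian `T* T + S S*` on `F`; its domain is
`{u ∈ dom T ∩ dom S* : T u ∈ dom T*, S* u ∈ dom S}`. -/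
def laplacian (S : E →ₗ.[ℂ] F) (T : F →ₗ.[ℂ] G) : F →ₗ.[ℂ] F :=
  comp (adj T) T + comp S (adj S)

/-- The space `dom T ∩ dom S*`, to be endowed with the graph norm `(‖T u‖² + ‖S* u‖²)^{1/2}`. -/
def GraphSpace (S : E →ₗ.[ℂ] F) (T : F →ₗ.[ℂ] G) : Type _ := ↥(T.domain ⊓ (adj S).domain)

namespace GraphSpace

variable {S : E →ₗ.[ℂ] F} {T : F →ₗ.[ℂ] G}

instance : AddCommGroup (GraphSpace S T) :=
  inferInstanceAs (AddCommGroup ↥(T.domain ⊓ (adj S).domain))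

instance : Module ℂ (GraphSpace S T) :=
  inferInstanceAs (Module ℂ ↥(T.domain ⊓ (adj S).domain))

/-- The embedding `ι : dom T ∩ dom S* → F`, `u ↦ u`. -/
def incl (S : E →ₗ.[ℂ] F) (T : F →ₗ.[ℂ] G) : GraphSpace S T →ₗ[ℂ] F :=
  (T.domain ⊓ (adj S).domain).subtype

/-- `u ↦ T u` on `dom T ∩ dom S*`. -/
def applyT (S : E →ₗ.[ℂ] F) (T : F →ₗ.[ℂ] G) : GraphSpace S T →ₗ[ℂ] G :=
  T.toFun.comp (Submodule.inclusion inf_le_left)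

/-- `u ↦ S* u` on `dom T ∩ dom S*`. -/
def applySadj (S : E →ₗ.[ℂ] F) (T : F →ₗ.[ℂ] G) : GraphSpace S T →ₗ[ℂ] E :=
  (adj S).toFun.comp (Submodule.inclusion inf_le_right)

/-- The form `Q(u,v) = (T u, T v) + (S* u, S* v)`. In general it is only semidefinite. -/
instance innerCore : PreInnerProductSpace.Core ℂ (GraphSpace S T) where
  inner u v := inner ℂ (applyT S T u) (applyT S T v) + inner ℂ (applySadj S T u) (applySadj S T v)
  conj_inner_symm u v := by simp
  re_inner_nonneg u := by
    rw [map_add]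
    exact add_nonneg inner_self_nonneg inner_self_nonneg
  add_left u v w := by
    simp only [map_add, inner_add_left]
    ring
  smul_left u v c := by
    simp only [map_smul, inner_smul_left]
    ring

/-- The graph norm `(‖T u‖² + ‖S* u‖²)^{1/2}`. -/
instance : SeminormedAddCommGroup (GraphSpace S T) :=
  InnerProductSpace.Core.toSeminormedAddCommGroup (𝕜 := ℂ)

instance : InnerProductSpace ℂ (GraphSpace S T) := InnerProductSpace.ofCore innerCore

end GraphSpace

end HilbertComplex

/-! ### The complex Laplacian of the `∂`-complex -/

/-- The complex Laplacian `□̃_p = ∂*∂ + ∂∂*` on `A²_{(p,0)}(ℂⁿ, e^{-|z|²})`. -/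
def fockBox (n p : ℕ) : FockForm n p →ₗ.[ℂ] FockForm n p :=
  HilbertComplex.laplacian (delPrev n p) (del n p)

/-- `dom ∂ ∩ dom ∂* ⊆ A²_{(p,0)}(ℂⁿ, e^{-|z|²})` with the graph norm. -/
abbrev FockGraphSpace (n p : ℕ) : Type :=
  HilbertComplex.GraphSpace (delPrev n p) (del n p)

/-- The embedding `ι` of `dom ∂ ∩ dom ∂*` into `A²_{(p,0)}(ℂⁿ, e^{-|z|²})`. -/
abbrev fockIncl (n p : ℕ) : FockGraphSpace n p →ₗ[ℂ] FockForm n p :=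
  HilbertComplex.GraphSpace.incl (delPrev n p) (del n p)

/-- `N` is the bounded inverse of the unbounded operator `A`: it maps the whole space into `dom A`,
and it is inverse to `A` from both sides. -/
def IsBoundedInverse {F : Type*} [NormedAddCommGroup F] [InnerProductSpace ℂ F]
    (A : F →ₗ.[ℂ] F) (N : F →L[ℂ] F) : Prop :=
  (∀ u : F, ∃ h : N u ∈ A.domain, A ⟨N u, h⟩ = u) ∧ ∀ v : A.domain, N (A v) = v

end

/-! In the Fock space the monomials z^α are orthogonal with squared norm πⁿα!, and multiplication by
z_k is adjoint to ∂/∂z_k. Hence ∂ = ∑ dz_k∧ ∂/∂z_k has the formal adjoint ∂* = ∑ z_k ι_k, with ι_k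
the contraction. The relations [∂/∂z_l, z_k] = δ_kl for coefficients and {ι_l, dz_k∧} = δ_kl for
forms then give □̃(z^α dz_J) = (|α| + p) z^α dz_J: the cross terms cancel, |α| comes from ∑ z_k
∂/∂z_k and p from ∑ dz_k∧ ι_k (`FockForm.taylorCoeff_fockBox_aux`).

So everything is diagonal in Taylor coefficients. Ñ divides by |α| + p, which is at least 1; Q(u,u)
is the sum of (|α| + p) πⁿα! |u_{J,α}|², and its |α| part is the sum of the norms of the first
derivatives, which is (a). As |α| + p tends to infinity and each degree carries finitely many
monomials, ι is a norm limit of finite rank operators.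

Two things need work. The first is the dictionary between functions and coefficients. Parseval's
identity in [0, ∞], proved by splitting off one variable at a time, makes membership in the Fock
space a condition on coefficients. Completeness then shows that every weighted square summable
family occurs (`Fock.toLp_surjective`), so operators can be prescribed by multipliers without
summing power series in several variables.

The second is domains: the formulas must hold on the full domains of ∂ and ∂*, not only on
polynomials. Truncation by degree commutes with ∂ and ∂* up to moving the cut-off by one
(`FockForm.trunc_del`, `FockForm.trunc_adj_del`). So forms with polynomial coefficients are dense in
the graph norm, and the diagonal formula for Q passes to the limit
(`FockForm.hasSum_graph_norm_sq`). Finally (□̃u, v) = Q(u, v) identifies ι* with Ñ regarded as a map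
into dom ∂ ∩ dom ∂*. -/

noncomputable section

/-! ### Entire functions: Cauchy's estimate, uniform limits, derivatives. -/

section Entire

open Filter Topology Metric

variable {E : Type*} [NormedAddCommGroup E] [NormedSpace ℂ E]

/-- Cauchy's estimate for the Fréchet derivative. -/
theorem norm_fderiv_le_of_forall_ball_norm_le {f : E → ℂ} {c : E} {R M : ℝ}
    (hR : 0 < R) (hf : DifferentiableOn ℂ f (ball c R)) (hM : ∀ z ∈ ball c R, ‖f z‖ ≤ M) :
    ‖fderiv ℂ f c‖ ≤ 2 * M / R := by
  refine Complex.norm_fderiv_le_div_of_mapsTo_ball hf (fun z hz => ?_) hR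
  rw [mem_closedBall, dist_eq_norm]
  linarith [norm_sub_le (f z) (f c), hM z hz, hM c (mem_ball_self hR)]

/-- A limit of entire functions that is uniform on balls is entire. -/
theorem Differentiable.of_tendstoUniformlyOn_ball {F : ℕ → E → ℂ} {f : E → ℂ}
    (hF : ∀ j, Differentiable ℂ (F j)) (h : ∀ R, TendstoUniformlyOn F f atTop (ball 0 R)) :
    Differentiable ℂ f := by
  intro z₀
  set R := ‖z₀‖ + 1
  have hc : UniformCauchySeqOn (fun j => fderiv ℂ (F j)) atTop (ball 0 R) := by
    rw [Metric.uniformCauchySeqOn_iff]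
    intro ε hε
    -- Cauchy's estimate on unit balls requires the radius R + 1 and doubles the bound, so ε / 4
    -- leaves ε / 2 < ε.
    obtain ⟨N, hN⟩ := Metric.uniformCauchySeqOn_iff.1 (h (R + 1)).uniformCauchySeqOn (ε / 4)
      (by positivity)
    refine ⟨N, fun m hm k hk x hx => ?_⟩
    have h1 : fderiv ℂ (F m) x - fderiv ℂ (F k) x = fderiv ℂ (F m - F k) x :=
      (fderiv_sub (hF m x) (hF k x)).symm
    rw [dist_eq_norm, h1]
    refine (norm_fderiv_le_of_forall_ball_norm_le one_pos ((hF m).sub (hF k)).differentiableOn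
      (M := ε / 4) fun z hz => ?_).trans_lt (by linarith)
    rw [Pi.sub_apply, ← dist_eq_norm]
    refine (hN m hm k hk z ?_).le
    rw [mem_ball_zero_iff] at hx ⊢
    rw [mem_ball, dist_eq_norm] at hz
    linarith [norm_le_norm_add_norm_sub' z x]
  have hl : ∀ x ∈ ball (0 : E) R, ∃ l, Tendsto (fun j => fderiv ℂ (F j) x) atTop (𝓝 l) :=
    fun x hx => cauchySeq_tendsto_of_complete (hc.cauchySeq hx)
  choose! g hg using hl
  have hz : z₀ ∈ ball (0 : E) R := by rw [mem_ball_zero_iff]; simp [R]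
  exact (hasFDerivAt_of_tendstoUniformlyOn isOpen_ball (hc.tendstoUniformlyOn_of_tendsto hg)
    (fun j x _ => (hF j x).hasFDerivAt) (fun x hx => (h R).tendsto_at hx) hz).differentiableAt

theorem Differentiable.exists_norm_le_ball [FiniteDimensional ℂ E] {f : E → ℂ}
    (hf : Differentiable ℂ f) (R : ℝ) : ∃ M, ∀ z ∈ ball (0 : E) R, ‖f z‖ ≤ M := by
  have : ProperSpace E := FiniteDimensional.proper ℂ E
  obtain ⟨M, hM⟩ := (isCompact_closedBall (0 : E) R).exists_bound_of_continuousOn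
    hf.continuous.continuousOn
  exact ⟨M, fun z hz => hM z (ball_subset_closedBall hz)⟩

/-- The directional derivatives of an entire function are entire. -/
theorem Differentiable.fderiv_apply [FiniteDimensional ℂ E] {f : E → ℂ} (hf : Differentiable ℂ f)
    (v : E) : Differentiable ℂ fun z => fderiv ℂ f z v := by
  have : ProperSpace E := FiniteDimensional.proper ℂ E
  borelize E
  let c : ℝ → ℂ := circleMap 0 1
  -- Cauchy's formula for the derivative of w ↦ f(z + w v) at 0 writes the directional derivative as
  -- an integral of f(z + c(θ) v) over the unit circle. The kernel κ = c'/c² has modulus 1, and z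
  -- enters only through f, so one can differentiate under the integral sign.
  let κ : ℝ → ℂ := fun θ => _root_.deriv c θ * ((c θ - 0) ^ 2)⁻¹
  have hcc : Continuous c := continuous_circleMap 0 1
  have hc1 : ∀ θ, ‖c θ‖ = 1 := fun θ => by simp [c]
  have hκ : Continuous κ := by
    have h0 : ∀ θ, (c θ - 0) ^ 2 ≠ 0 := fun θ => by
      have : c θ ≠ 0 := norm_ne_zero_iff.1 (by rw [hc1]; simp)
      simpa using this
    have h1 : Continuous (_root_.deriv c) := by
      simp only [c]
      have : _root_.deriv (circleMap 0 1) = fun θ => circleMap 0 1 θ * Complex.I := by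
        ext θ; simp [deriv_circleMap]
      rw [this]; fun_prop
    exact h1.mul (((hcc.sub continuous_const).pow 2).inv₀ h0)
  have hκ1 : ∀ θ, ‖κ θ‖ ≤ 1 := fun θ => by simp [κ, c, deriv_circleMap]
  have key : ∀ z, fderiv ℂ f z v =
      (2 * Real.pi * Complex.I : ℂ)⁻¹ • ∫ θ in (0 : ℝ)..2 * Real.pi, κ θ * f (z + c θ • v) := by
    intro z
    have hl : ∀ w : ℂ, HasDerivAt (fun w : ℂ => z + w • v) v w := fun w => by
      simpa using ((hasDerivAt_id w).smul_const v).const_add z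
    have hd : Differentiable ℂ fun w : ℂ => f (z + w • v) := fun w =>
      ((hf _).hasFDerivAt.comp_hasDerivAt w (hl w)).differentiableAt
    have h1 : _root_.deriv (fun w : ℂ => f (z + w • v)) 0 = fderiv ℂ f z v := by
      have := ((hf (z + (0 : ℂ) • v)).hasFDerivAt.comp_hasDerivAt 0 (hl 0)).deriv
      simpa [Function.comp_def] using this
    rw [← h1, ← Complex.two_pi_I_inv_smul_circleIntegral_sub_sq_inv_smul_of_differentiable
      isOpen_univ (Set.subset_univ (closedBall 0 1)) hd.differentiableOn (mem_ball_self one_pos)]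
    congr 1
    rw [circleIntegral]
    simp only [smul_eq_mul, κ, c, mul_assoc]
  intro z₀
  -- The radius adds up the distance of z from 0, the circle of radius ‖v‖, and a unit ball for
  -- Cauchy's estimate.
  obtain ⟨M, hM⟩ := hf.exists_norm_le_ball (‖z₀‖ + 1 + ‖v‖ + 1)
  have hfd : ∀ z ∈ ball z₀ 1, ∀ θ, ‖fderiv ℂ f (z + c θ • v)‖ ≤ 2 * M := by
    intro z hz θ
    refine (norm_fderiv_le_of_forall_ball_norm_le (R := 1) (M := M) one_pos hf.differentiableOn
      fun w hw => hM w ?_).trans (by simp)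
    rw [mem_ball, dist_eq_norm] at hz hw
    rw [mem_ball_zero_iff]
    have h1 := norm_le_norm_add_norm_sub' w (z + c θ • v)
    have h2 := norm_add_le z (c θ • v)
    have h3 := norm_le_norm_add_norm_sub' z z₀
    rw [norm_smul, hc1, one_mul] at h2
    linarith
  have hcont : ∀ z : E, Continuous fun θ => κ θ * f (z + c θ • v) := fun z =>
    hκ.mul (hf.continuous.comp (continuous_const.add (hcc.smul continuous_const)))
  have main := intervalIntegral.hasFDerivAt_integral_of_dominated_of_fderiv_le (𝕜 := ℂ)
    (μ := MeasureTheory.volume) (a := 0) (b := 2 * Real.pi) (bound := fun _ => 2 * M)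
    (F := fun z θ => κ θ * f (z + c θ • v)) (F' := fun z θ => κ θ • fderiv ℂ f (z + c θ • v))
    (ball_mem_nhds z₀ one_pos) (Eventually.of_forall fun z => (hcont z).aestronglyMeasurable)
    ((hcont z₀).intervalIntegrable _ _) ?_ ?_ intervalIntegrable_const ?_
  · have h2 : (fun z => fderiv ℂ f z v) = fun z => (2 * Real.pi * Complex.I : ℂ)⁻¹ •
        ∫ θ in (0 : ℝ)..2 * Real.pi, κ θ * f (z + c θ • v) := funext key
    rw [h2]
    exact main.differentiableAt.const_smul (2 * Real.pi * Complex.I : ℂ)⁻¹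
  -- Measurability of the derivative is enough here; its continuity is close to what is being
  -- proved.
  · have h1 : Measurable fun θ => fderiv ℂ f (z₀ + c θ • v) :=
      (measurable_fderiv ℂ f).comp
        (continuous_const.add (hcc.smul continuous_const)).measurable
    exact hκ.aestronglyMeasurable.smul h1.aestronglyMeasurable
  · refine Eventually.of_forall fun θ _ z hz => ?_
    rw [norm_smul]
    have := hfd z hz θ
    nlinarith [hκ1 θ, norm_nonneg (κ θ), norm_nonneg (fderiv ℂ f (z + c θ • v))]
  · refine Eventually.of_forall fun θ _ z _ => ?_
    have h1 : HasFDerivAt (fun z => z + c θ • v) (ContinuousLinearMap.id ℂ E) z :=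
      (hasFDerivAt_id z).add_const _
    simpa using ((hf (z + c θ • v)).hasFDerivAt.comp z h1).const_mul (κ θ)

end Entire

/-! ### Commuting partial derivatives. -/

section PartialDerivatives

variable {n : ℕ}

theorem differentiable_dz {f : (Fin n → ℂ) → ℂ} (hf : Differentiable ℂ f) (k : Fin n) :
    Differentiable ℂ (dz k f) := hf.fderiv_apply _

theorem fderiv_eq_sum_dz (f : (Fin n → ℂ) → ℂ) (z : Fin n → ℂ) :
    fderiv ℂ f z = ∑ k, dz k f z • ContinuousLinearMap.proj (R := ℂ) (φ := fun _ => ℂ) k := by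
  ext v
  have hv : v = ∑ k, v k • Pi.single k (1 : ℂ) := by
    ext i; simp [Finset.sum_apply, Pi.single_apply]
  conv_lhs => rw [hv, map_sum]
  simp [dz, mul_comm]

theorem dz_comm {f : (Fin n → ℂ) → ℂ} (hf : Differentiable ℂ f) (j k : Fin n) :
    dz j (dz k f) = dz k (dz j f) := by
  have hd : Differentiable ℂ (fderiv ℂ f) := by
    rw [funext (fderiv_eq_sum_dz f)]
    exact Differentiable.fun_sum fun k _ => (differentiable_dz hf k).smul_const _
  ext z
  have h1 : ∀ i l, dz i (dz l f) z = fderiv ℂ (fderiv ℂ f) z (Pi.single i 1) (Pi.single l 1) := by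
    intro i l
    have : HasFDerivAt (dz l f)
        ((ContinuousLinearMap.apply ℂ ℂ (Pi.single l 1)).comp (fderiv ℂ (fderiv ℂ f) z)) z :=
      ((ContinuousLinearMap.apply ℂ ℂ (Pi.single l (1 : ℂ) : Fin n → ℂ)).hasFDerivAt
        (x := fderiv ℂ f z)).comp z (hd z).hasFDerivAt
    rw [dz, this.fderiv]
    simp
  rw [h1, h1]
  exact second_derivative_symmetric (fun y => (hf y).hasFDerivAt) (hd z).hasFDerivAt _ _

end PartialDerivatives

/-! ### Parseval's identity in one variable, by polar coordinates. -/

section OneVariable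

open MeasureTheory Real

theorem integral_exp_int_mul_I (k : ℤ) :
    ∫ θ in -π..π, Complex.exp (k * θ * Complex.I) = if k = 0 then 2 * π else 0 := by
  split_ifs with hk
  · subst hk
    simp
    ring
  · have hc : (k * Complex.I : ℂ) ≠ 0 := by simp [hk]
    have h1 : ∀ θ : ℝ, Complex.exp (k * θ * Complex.I) = Complex.exp (k * Complex.I * θ) :=
      fun θ => by ring_nf
    simp_rw [h1]
    rw [integral_exp_mul_complex hc]
    have h2 : Complex.exp (k * Complex.I * π) = Complex.exp (k * Complex.I * (-π : ℝ)) := by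
      rw [Complex.exp_eq_exp_iff_exists_int]
      exact ⟨k, by push_cast; ring⟩
    rw [h2]
    simp

/-- Termwise integration against a test function φ. It is applied with φ a character, which isolates
a coefficient, and with φ the conjugate of the sum itself. -/
theorem hasSum_integral_mul_trigonometric {b : ℕ → ℂ} (hb : Summable fun m => ‖b m‖) {φ : ℝ → ℂ}
    (hφ : Continuous φ) :
    HasSum (fun m : ℕ => ∫ θ in -π..π, φ θ * (b m * Complex.exp (m * θ * Complex.I)))
      (∫ θ in -π..π, φ θ * ∑' m : ℕ, b m * Complex.exp (m * θ * Complex.I)) := by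
  have hn : ∀ (m : ℕ) (θ : ℝ), ‖b m * Complex.exp (m * θ * Complex.I)‖ = ‖b m‖ := fun m θ => by
    have : (m * θ * Complex.I : ℂ) = ((m * θ : ℝ) : ℂ) * Complex.I := by push_cast; ring
    rw [norm_mul, this, Complex.norm_exp_ofReal_mul_I, mul_one]
  refine intervalIntegral.hasSum_integral_of_dominated_convergence
    (fun m θ => ‖φ θ‖ * ‖b m‖) (fun m => ?_) (fun m => ?_) ?_ ?_ ?_
  · refine Continuous.aestronglyMeasurable ?_
    fun_prop
  · exact Filter.Eventually.of_forall fun θ _ => by rw [norm_mul, hn]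
  · exact Filter.Eventually.of_forall fun θ _ => hb.mul_left _
  · simp_rw [tsum_mul_left]
    exact (hφ.norm.mul continuous_const).intervalIntegrable _ _
  · refine Filter.Eventually.of_forall fun θ _ => HasSum.mul_left _ (Summable.hasSum ?_)
    refine Summable.of_norm ?_
    simp_rw [hn]
    exact hb

/-- Parseval's identity on the circle, for absolutely convergent series. -/
theorem hasSum_integral_norm_sq_trigonometric {b : ℕ → ℂ} (hb : Summable fun m => ‖b m‖) {h : ℝ → ℂ}
    (hh : Continuous h) (hbh : ∀ θ : ℝ, ∑' m : ℕ, b m * Complex.exp (m * θ * Complex.I) = h θ) :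
    HasSum (fun m : ℕ => 2 * π * ‖b m‖ ^ 2) (∫ θ in -π..π, ‖h θ‖ ^ 2) := by
  have h1 : ∀ l : ℕ, ∫ θ in -π..π, Complex.exp (-(l * θ * Complex.I)) * h θ = 2 * π * b l := by
    intro l
    have hs := hasSum_integral_mul_trigonometric hb
      (φ := fun θ => Complex.exp (-(l * θ * Complex.I))) (by fun_prop)
    simp_rw [hbh] at hs
    refine hs.unique ?_
    have h2 : ∀ m : ℕ, ∫ θ in -π..π, Complex.exp (-(l * θ * Complex.I)) *
        (b m * Complex.exp (m * θ * Complex.I)) = if m = l then 2 * π * b l else 0 := by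
      intro m
      have h3 : ∀ θ : ℝ, Complex.exp (-(l * θ * Complex.I)) *
          (b m * Complex.exp (m * θ * Complex.I)) =
          b m * Complex.exp (((m - l : ℤ) : ℂ) * θ * Complex.I) := fun θ => by
        rw [mul_left_comm, ← Complex.exp_add]
        congr 2
        push_cast
        ring
      simp_rw [h3]
      rw [intervalIntegral.integral_const_mul, integral_exp_int_mul_I]
      by_cases hml : m = l
      · subst hml; simp; ring
      · rw [if_neg (by omega), if_neg hml, Complex.ofReal_zero, mul_zero]
    simp_rw [h2]
    simpa using hasSum_ite_eq l (2 * π * b l)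
  have hs := hasSum_integral_mul_trigonometric hb (φ := fun θ => conj (h θ))
    (Complex.continuous_conj.comp hh)
  simp_rw [hbh] at hs
  have h4 : ∀ m : ℕ, ∫ θ in -π..π, conj (h θ) * (b m * Complex.exp (m * θ * Complex.I)) =
      ((2 * π * ‖b m‖ ^ 2 : ℝ) : ℂ) := by
    intro m
    have h5 : ∀ θ : ℝ, conj (h θ) * (b m * Complex.exp (m * θ * Complex.I)) =
        b m * conj (Complex.exp (-(m * θ * Complex.I)) * h θ) := fun θ => by
      rw [map_mul, ← Complex.exp_conj]
      simp
      ring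
    simp_rw [h5]
    rw [intervalIntegral.integral_const_mul]
    have h6 : ∫ θ in -π..π, conj (Complex.exp (-(m * θ * Complex.I)) * h θ) =
        conj (∫ θ in -π..π, Complex.exp (-(m * θ * Complex.I)) * h θ) := by
      simp only [intervalIntegral, map_sub, integral_conj]
    rw [h6, h1]
    push_cast
    rw [← Complex.mul_conj']
    simp only [map_mul, Complex.conj_ofReal, map_ofNat]
    ring
  simp_rw [h4] at hs
  have h7 : ∫ θ in -π..π, conj (h θ) * h θ = ((∫ θ in -π..π, ‖h θ‖ ^ 2 : ℝ) : ℂ) := by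
    rw [← intervalIntegral.integral_ofReal]
    refine intervalIntegral.integral_congr fun θ _ => ?_
    simp only [Complex.conj_mul']
    push_cast
    rfl
  rw [h7] at hs
  exact_mod_cast hs

theorem lintegral_gaussian_moment (m : ℕ) :
    ∫⁻ r in Set.Ioi (0 : ℝ), ENNReal.ofReal (2 * π * r ^ (2 * m + 1) * exp (-r ^ 2)) =
      ENNReal.ofReal (π * m.factorial) := by
  have h1 := integral_rpow_mul_exp_neg_rpow (p := 2) (q := 2 * m + 1) (by norm_num)
    (by have : (0 : ℝ) ≤ m := m.cast_nonneg
        linarith)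
  have h2 : ∀ r : ℝ, r ^ (2 * m + 1 : ℝ) * exp (-r ^ (2 : ℝ)) = r ^ (2 * m + 1) * exp (-r ^ 2) :=
    fun r => by
      rw [Real.rpow_two, ← Real.rpow_natCast r (2 * m + 1)]
      push_cast
      rfl
  have h3 : ((2 * m + 1 + 1 : ℝ) / 2) = m + 1 := by ring
  simp_rw [h2] at h1
  rw [h3, Real.Gamma_nat_eq_factorial] at h1
  have hpos : 0 < ∫ r in Set.Ioi (0 : ℝ), r ^ (2 * m + 1) * exp (-r ^ 2) := by
    rw [h1]; positivity
  -- A nonzero Bochner integral already forces integrability.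
  have hi : IntegrableOn (fun r : ℝ => r ^ (2 * m + 1) * exp (-r ^ 2)) (Set.Ioi 0) :=
    Integrable.of_integral_ne_zero hpos.ne'
  rw [← ofReal_integral_eq_lintegral_ofReal]
  · congr 1
    simp_rw [mul_assoc (2 * π)]
    rw [integral_const_mul, h1]
    ring
  · simp_rw [mul_assoc (2 * π)]
    exact hi.const_mul _
  · refine (ae_restrict_iff' measurableSet_Ioi).2 (Filter.Eventually.of_forall fun r hr => ?_)
    have : (0 : ℝ) < r := hr
    positivity

/-- Parseval's identity in the Fock space of one variable. -/
theorem lintegral_norm_sq_gaussian_one {g : ℂ → ℂ} (hg : Differentiable ℂ g) :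
    ∫⁻ w, ENNReal.ofReal (‖g w‖ ^ 2 * exp (-‖w‖ ^ 2)) =
      ∑' m : ℕ, ENNReal.ofReal (π * m.factorial) *
        ENNReal.ofReal (‖(m.factorial : ℂ)⁻¹ * iteratedDeriv m g 0‖ ^ 2) := by
  set a : ℕ → ℂ := fun m => (m.factorial : ℂ)⁻¹ * iteratedDeriv m g 0
  have ha : ∀ w, HasSum (fun m => a m * w ^ m) (g w) := fun w => by
    have := Complex.hasSum_taylorSeries_of_entire hg 0 w
    simp_rw [sub_zero, smul_eq_mul] at this
    have h0 : ∀ m : ℕ, (m.factorial : ℂ)⁻¹ * (w ^ m * iteratedDeriv m g 0) = a m * w ^ m :=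
      fun m => by simp only [a]; ring
    simpa only [h0] using this
  have hgc := hg.continuous
  have hsymm : ∀ r θ : ℝ, Complex.polarCoord.symm (r, θ) = r * Complex.exp (θ * Complex.I) :=
    fun r θ => by
      simp [Complex.polarCoord_symm_apply, Complex.exp_mul_I]
  -- Parseval on the circle of radius r. The Jacobian r of polar coordinates turns r^(2m) into
  -- r^(2m+1), whose Gaussian moment is π m!.
  have hcirc : ∀ r ∈ Set.Ioi (0 : ℝ), ∫⁻ θ in Set.Ioo (-π) π,
      ENNReal.ofReal r • ENNReal.ofReal (‖g (Complex.polarCoord.symm (r, θ))‖ ^ 2 *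
        exp (-‖Complex.polarCoord.symm (r, θ)‖ ^ 2)) =
      ∑' m : ℕ, ENNReal.ofReal (2 * π * r ^ (2 * m + 1) * exp (-r ^ 2)) *
        ENNReal.ofReal (‖a m‖ ^ 2) := by
    intro r hr
    have hr0 : (0 : ℝ) < r := hr
    have hs := hasSum_integral_norm_sq_trigonometric (b := fun m => a m * r ^ m)
      (h := fun θ => g (r * Complex.exp (θ * Complex.I))) ?_ (by fun_prop) ?_
    rotate_left
    · exact (ha r).summable.norm
    · intro θ
      rw [← (ha (r * Complex.exp (θ * Complex.I))).tsum_eq]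
      refine tsum_congr fun m => ?_
      rw [mul_pow, ← Complex.exp_nat_mul]
      ring_nf
    have h1 : ∀ θ : ℝ, ENNReal.ofReal r • ENNReal.ofReal
        (‖g (Complex.polarCoord.symm (r, θ))‖ ^ 2 *
          exp (-‖Complex.polarCoord.symm (r, θ)‖ ^ 2)) =
        ENNReal.ofReal (r * exp (-r ^ 2)) *
          ENNReal.ofReal (‖g (r * Complex.exp (θ * Complex.I))‖ ^ 2) := fun θ => by
      rw [hsymm, smul_eq_mul, ← ENNReal.ofReal_mul hr0.le, ← ENNReal.ofReal_mul (by positivity),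
        norm_mul, Complex.norm_exp_ofReal_mul_I, Complex.norm_real, Real.norm_of_nonneg hr0.le]
      ring_nf
    simp_rw [h1]
    have hcont : Continuous fun θ : ℝ => ‖g (r * Complex.exp (θ * Complex.I))‖ ^ 2 := by fun_prop
    rw [lintegral_const_mul' _ _ ENNReal.ofReal_ne_top, ← ofReal_integral_eq_lintegral_ofReal,
      ← integral_Ioc_eq_integral_Ioo, ← intervalIntegral.integral_of_le (by linarith [pi_pos]),
      ← hs.tsum_eq, ENNReal.ofReal_tsum_of_nonneg (fun m => by positivity) hs.summable,
      ← ENNReal.tsum_mul_left]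
    · refine tsum_congr fun m => ?_
      rw [← ENNReal.ofReal_mul (by positivity), ← ENNReal.ofReal_mul (by positivity)]
      congr 1
      rw [norm_mul, norm_pow, Complex.norm_real, Real.norm_of_nonneg hr0.le]
      ring
    · exact (hcont.integrableOn_Icc (a := -π) (b := π)).mono_set Set.Ioo_subset_Icc_self
    · exact Filter.Eventually.of_forall fun θ => by positivity
  rw [← Complex.lintegral_comp_polarCoord_symm, polarCoord_target, Measure.volume_eq_prod,
    setLIntegral_prod]
  · rw [setLIntegral_congr_fun measurableSet_Ioi hcirc, lintegral_tsum]
    · refine tsum_congr fun m => ?_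
      rw [lintegral_mul_const' _ _ ENNReal.ofReal_ne_top, lintegral_gaussian_moment]
    · intro m
      fun_prop
  · have : Continuous fun p : ℝ × ℝ => Complex.polarCoord.symm p := by
      simp only [Complex.polarCoord_symm_apply]
      fun_prop
    have h2 : Continuous fun p : ℝ × ℝ => ‖g (Complex.polarCoord.symm p)‖ ^ 2 *
      exp (-‖Complex.polarCoord.symm p‖ ^ 2) := by fun_prop
    exact ((ENNReal.measurable_ofReal.comp measurable_fst).smul
      (ENNReal.measurable_ofReal.comp h2.measurable)).aemeasurable

end OneVariable

/-! ### Taylor coefficients and the weights πⁿα!. -/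

/-- The Taylor coefficients at the origin of an entire function of `n` variables. -/
def taylorCoeff : (n : ℕ) → ((Fin n → ℂ) → ℂ) → (Fin n → ℕ) → ℂ
  | 0, f, _ => f 0
  -- The coefficient of z_0^(α 0) is itself an entire function of the remaining variables, and is
  -- expanded in turn.
  | n + 1, f, α => ((α 0).factorial : ℂ)⁻¹ *
      taylorCoeff n (fun w => (dz 0)^[α 0] f (Fin.cons 0 w)) (Fin.tail α)

/-- The square `πⁿ α!` of the norm of the monomial `z ^ α` in the Fock space. -/
def monomialWeight {n : ℕ} (α : Fin n → ℕ) : ℝ := ∏ i, (Real.pi * (α i).factorial)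

theorem monomialWeight_pos {n : ℕ} (α : Fin n → ℕ) : 0 < monomialWeight α :=
  Finset.prod_pos fun _ _ => by positivity

/-- The recursion for α!, which is what makes multiplication by z_k adjoint to ∂/∂z_k. -/
theorem monomialWeight_add_single {n : ℕ} (α : Fin n → ℕ) (k : Fin n) :
    monomialWeight (α + Pi.single k 1) = (α k + 1) * monomialWeight α := by
  unfold monomialWeight
  rw [← Finset.mul_prod_erase _ _ (Finset.mem_univ k), ← Finset.mul_prod_erase _
    (fun i => Real.pi * ((α i).factorial : ℝ)) (Finset.mem_univ k)]
  have h : ∀ i ∈ Finset.univ.erase k, Real.pi * (((α + Pi.single k 1 : Fin n → ℕ) i).factorial : ℝ) =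
      Real.pi * (α i).factorial := fun i hi => by
    simp [Pi.single_eq_of_ne (Finset.ne_of_mem_erase hi)]
  rw [Finset.prod_congr rfl h]
  simp [Nat.factorial_succ]
  ring

/-! ### Slicing off the first variable; iterated partial derivatives of sums and products. -/

section Calculus

variable {n : ℕ}

theorem hasDerivAt_comp_cons {f : (Fin (n + 1) → ℂ) → ℂ} (hf : Differentiable ℂ f)
    (w : Fin n → ℂ) (x : ℂ) :
    HasDerivAt (fun x => f (Fin.cons x w)) (dz 0 f (Fin.cons x w)) x := by
  have h : ∀ x : ℂ, (Fin.cons x w : Fin (n + 1) → ℂ) =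
      Fin.cons 0 w + x • (Pi.single 0 1 : Fin (n + 1) → ℂ) := fun x => by
    ext i
    refine Fin.cases ?_ (fun j => ?_) i
    · simp only [Fin.cons_zero, Pi.add_apply, Pi.smul_apply, Pi.single_eq_same, smul_eq_mul,
        mul_one, zero_add]
    · simp only [Fin.cons_succ, Pi.add_apply, Pi.smul_apply, smul_eq_mul,
        Pi.single_eq_of_ne (Fin.succ_ne_zero j), mul_zero, add_zero]
  have h1 : HasDerivAt (fun x : ℂ => (Fin.cons x w : Fin (n + 1) → ℂ)) (Pi.single 0 1) x := by
    rw [funext h]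
    have h2 := ((hasDerivAt_id x).smul_const (Pi.single 0 1 : Fin (n + 1) → ℂ)).const_add
      (Fin.cons 0 w : Fin (n + 1) → ℂ)
    rw [one_smul] at h2
    exact h2
  exact (hf _).hasFDerivAt.comp_hasDerivAt x h1

theorem hasFDerivAt_cons_zero (w : Fin n → ℂ) :
    HasFDerivAt (fun w => (Fin.cons 0 w : Fin (n + 1) → ℂ))
      (ContinuousLinearMap.pi (Fin.cons 0 fun j => ContinuousLinearMap.proj j) :
        (Fin n → ℂ) →L[ℂ] (Fin (n + 1) → ℂ)) w := by
  have h : (fun w => (Fin.cons 0 w : Fin (n + 1) → ℂ)) =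
      (ContinuousLinearMap.pi (Fin.cons 0 fun j => ContinuousLinearMap.proj j) :
        (Fin n → ℂ) →L[ℂ] (Fin (n + 1) → ℂ)) := by
    ext w i
    refine Fin.cases ?_ (fun j => ?_) i <;> simp
  rw [h]
  exact ContinuousLinearMap.hasFDerivAt _

theorem differentiable_comp_cons_zero {f : (Fin (n + 1) → ℂ) → ℂ} (hf : Differentiable ℂ f) :
    Differentiable ℂ fun w : Fin n → ℂ => f (Fin.cons 0 w) := fun w =>
  ((hf _).hasFDerivAt.comp w (hasFDerivAt_cons_zero w)).differentiableAt

theorem dz_comp_cons_zero {f : (Fin (n + 1) → ℂ) → ℂ} (hf : Differentiable ℂ f) (j : Fin n)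
    (w : Fin n → ℂ) : dz j (fun w => f (Fin.cons 0 w)) w = dz j.succ f (Fin.cons 0 w) := by
  have h := ((hf _).hasFDerivAt.comp w (hasFDerivAt_cons_zero w)).fderiv
  simp only [Function.comp_def] at h
  rw [dz, h, dz, ContinuousLinearMap.comp_apply]
  congr 1
  ext i
  refine Fin.cases ?_ (fun l => ?_) i
  · simp
  · simp [Pi.single_apply]

theorem dz_add {f g : (Fin n → ℂ) → ℂ} (hf : Differentiable ℂ f) (hg : Differentiable ℂ g)
    (k : Fin n) : dz k (f + g) = dz k f + dz k g := by
  ext z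
  rw [dz, fderiv_add (hf z) (hg z)]
  rfl

theorem dz_const_smul {f : (Fin n → ℂ) → ℂ} (hf : Differentiable ℂ f) (c : ℂ) (k : Fin n) :
    dz k (c • f) = c • dz k f := by
  ext z
  rw [dz, fderiv_const_smul (hf z)]
  rfl

theorem differentiable_coord_mul {f : (Fin n → ℂ) → ℂ} (hf : Differentiable ℂ f) (k : Fin n) :
    Differentiable ℂ fun z => z k * f z :=
  (differentiable_apply k).mul hf

theorem dz_coord_mul {f : (Fin n → ℂ) → ℂ} (hf : Differentiable ℂ f) (j k : Fin n) :
    dz j (fun z => z k * f z) = fun z => (if j = k then f z else 0) + z k * dz j f z := by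
  ext z
  have h := ((hasFDerivAt_apply (𝕜 := ℂ) k z).mul (hf z).hasFDerivAt).fderiv
  rw [dz, show (fun z : Fin n → ℂ => z k * f z) = (fun z => z k) * f from rfl, h]
  by_cases hjk : j = k
  · subst hjk
    simp [dz]; ring
  · simp [dz, hjk]

theorem differentiable_iterate_dz {f : (Fin n → ℂ) → ℂ} (hf : Differentiable ℂ f) (k : Fin n)
    (m : ℕ) : Differentiable ℂ ((dz k)^[m] f) := by
  induction m with
  | zero => exact hf
  | succ m ih => rw [Function.iterate_succ_apply']; exact differentiable_dz ih k

theorem iterate_dz_dz {f : (Fin n → ℂ) → ℂ} (hf : Differentiable ℂ f) (j k : Fin n) (m : ℕ) :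
    (dz j)^[m] (dz k f) = dz k ((dz j)^[m] f) := by
  induction m with
  | zero => rfl
  | succ m ih =>
    rw [Function.iterate_succ_apply', ih, dz_comm (differentiable_iterate_dz hf j m),
      Function.iterate_succ_apply']

theorem iterate_dz_coord_mul_of_ne {f : (Fin n → ℂ) → ℂ} (hf : Differentiable ℂ f) {j k : Fin n}
    (hjk : j ≠ k) (m : ℕ) :
    (dz j)^[m] (fun z => z k * f z) = fun z => z k * (dz j)^[m] f z := by
  induction m with
  | zero => rfl
  | succ m ih =>
    rw [Function.iterate_succ_apply', ih, dz_coord_mul (differentiable_iterate_dz hf j m),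
      Function.iterate_succ_apply']
    simp [hjk]

/-- Leibniz' rule. At m = 0 the truncated exponent m - 1 is harmless because its term has the factor
m. -/
theorem iterate_dz_coord_mul_self {f : (Fin n → ℂ) → ℂ} (hf : Differentiable ℂ f) (k : Fin n)
    (m : ℕ) : (dz k)^[m] (fun z => z k * f z) =
      fun z => m * (dz k)^[m - 1] f z + z k * (dz k)^[m] f z := by
  induction m with
  | zero => simp
  | succ m ih =>
    have h1 : (fun z => (m : ℂ) * (dz k)^[m - 1] f z + z k * (dz k)^[m] f z) =
        (m : ℂ) • (dz k)^[m - 1] f + fun z => z k * (dz k)^[m] f z := rfl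
    rw [Function.iterate_succ_apply', ih, h1,
      dz_add ((differentiable_iterate_dz hf k _).const_smul _)
        (differentiable_coord_mul (differentiable_iterate_dz hf k m) k),
      dz_const_smul (differentiable_iterate_dz hf k _),
      dz_coord_mul (differentiable_iterate_dz hf k m)]
    ext z
    cases m with
    | zero => simp
    | succ m =>
      simp only [Nat.add_sub_cancel, ← Function.iterate_succ_apply' (dz k), Pi.add_apply,
        Pi.smul_apply, smul_eq_mul, if_true]
      push_cast
      ring

theorem iterate_dz_add {f g : (Fin n → ℂ) → ℂ} (hf : Differentiable ℂ f)
    (hg : Differentiable ℂ g) (k : Fin n) (m : ℕ) :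
    (dz k)^[m] (f + g) = (dz k)^[m] f + (dz k)^[m] g := by
  induction m with
  | zero => rfl
  | succ m ih =>
    rw [Function.iterate_succ_apply', ih, dz_add (differentiable_iterate_dz hf k m)
      (differentiable_iterate_dz hg k m), Function.iterate_succ_apply',
      Function.iterate_succ_apply']

theorem iterate_dz_const_smul {f : (Fin n → ℂ) → ℂ} (hf : Differentiable ℂ f) (c : ℂ)
    (k : Fin n) (m : ℕ) : (dz k)^[m] (c • f) = c • (dz k)^[m] f := by
  induction m with
  | zero => rfl
  | succ m ih =>
    rw [Function.iterate_succ_apply', ih, dz_const_smul (differentiable_iterate_dz hf k m),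
      Function.iterate_succ_apply']

end Calculus

/-! ### Differentiation and multiplication by z_k as weighted shifts of coefficients. -/

section Coefficients

theorem taylorCoeff_add : ∀ {n : ℕ} {f g : (Fin n → ℂ) → ℂ}, Differentiable ℂ f →
    Differentiable ℂ g → ∀ α, taylorCoeff n (f + g) α = taylorCoeff n f α + taylorCoeff n g α
  | 0, _, _, _, _, _ => rfl
  | n + 1, f, g, hf, hg, α => by
    have h := taylorCoeff_add
      (differentiable_comp_cons_zero (differentiable_iterate_dz hf 0 (α 0)))
      (differentiable_comp_cons_zero (differentiable_iterate_dz hg 0 (α 0))) (Fin.tail α)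
    simp only [taylorCoeff]
    rw [iterate_dz_add hf hg, ← mul_add, ← h]
    rfl

theorem taylorCoeff_const_smul : ∀ {n : ℕ} {f : (Fin n → ℂ) → ℂ}, Differentiable ℂ f →
    ∀ (c : ℂ) (α), taylorCoeff n (c • f) α = c * taylorCoeff n f α
  | 0, _, _, _, _ => rfl
  | n + 1, f, hf, c, α => by
    have h := taylorCoeff_const_smul
      (differentiable_comp_cons_zero (differentiable_iterate_dz hf 0 (α 0))) c (Fin.tail α)
    simp only [taylorCoeff]
    rw [iterate_dz_const_smul hf, mul_left_comm, ← h]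
    rfl

/-- For k = 0 the extra derivative only changes the factorial by the factor α_0 + 1. For other k the
derivative commutes with those in z_0 and with restriction to z_0 = 0, so the claim follows by
induction on the number of variables. -/
theorem taylorCoeff_dz : ∀ {n : ℕ} {f : (Fin n → ℂ) → ℂ}, Differentiable ℂ f →
    ∀ (k : Fin n) (α), taylorCoeff n (dz k f) α = (α k + 1) * taylorCoeff n f (α + Pi.single k 1)
  | 0, _, _, k, _ => k.elim0
  | n + 1, f, hf, k, α => by
    refine Fin.cases ?_ (fun j => ?_) k
    · have ht : Fin.tail (α + Pi.single 0 1) = Fin.tail α := by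
        ext i; simp [Fin.tail]
      simp only [taylorCoeff, ht, Pi.add_apply, Pi.single_eq_same, Function.iterate_succ_apply,
        Nat.factorial_succ]
      rw [← mul_assoc]
      congr 1
      have : ((α 0 : ℂ) + 1) ≠ 0 := Nat.cast_add_one_ne_zero _
      push_cast
      field_simp
    · have h := taylorCoeff_dz
        (differentiable_comp_cons_zero (differentiable_iterate_dz hf 0 (α 0))) j (Fin.tail α)
      have ht : Fin.tail (α + Pi.single j.succ 1) = Fin.tail α + Pi.single j 1 := by
        ext i; simp [Fin.tail, Pi.single_apply]
      have h0 : (α + Pi.single j.succ 1 : Fin (n + 1) → ℕ) 0 = α 0 := by simp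
      simp only [taylorCoeff]
      rw [h0, ht, iterate_dz_dz hf, mul_left_comm]
      have h2 : (fun w : Fin n → ℂ => dz j.succ ((dz 0)^[α 0] f) (Fin.cons 0 w)) =
          dz j fun w => (dz 0)^[α 0] f (Fin.cons 0 w) := by
        ext w
        rw [dz_comp_cons_zero (differentiable_iterate_dz hf 0 (α 0))]
      rw [h2, h]
      rfl

/-- For k = 0, putting z_0 = 0 leaves only the term m ∂^(m-1) of Leibniz' rule, and m / m! = 1 /
(m-1)!. Other variables are inert under the expansion in z_0. -/
theorem taylorCoeff_coord_mul : ∀ {n : ℕ} {f : (Fin n → ℂ) → ℂ}, Differentiable ℂ f →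
    ∀ (k : Fin n) (α), taylorCoeff n (fun z => z k * f z) α =
      if α k = 0 then 0 else taylorCoeff n f (α - Pi.single k 1)
  | 0, _, _, k, _ => k.elim0
  | n + 1, f, hf, k, α => by
    refine Fin.cases ?_ (fun j => ?_) k
    · have ht : Fin.tail (α - Pi.single 0 1) = Fin.tail α := by
        ext i; simp [Fin.tail]
      simp only [taylorCoeff, ht, Pi.sub_apply, Pi.single_eq_same, iterate_dz_coord_mul_self hf,
        Fin.cons_zero, zero_mul, add_zero]
      have h := taylorCoeff_const_smul
        (differentiable_comp_cons_zero (differentiable_iterate_dz hf 0 (α 0 - 1))) (α 0)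
        (Fin.tail α)
      have h2 : ((α 0 : ℂ) • fun w : Fin n → ℂ => (dz 0)^[α 0 - 1] f (Fin.cons 0 w)) =
        fun w => (α 0 : ℂ) * (dz 0)^[α 0 - 1] f (Fin.cons 0 w) := rfl
      rw [← h2, h]
      rcases Nat.eq_zero_or_pos (α 0) with h0 | h0
      · simp [h0]
      · rw [if_neg h0.ne', ← mul_assoc]
        congr 1
        rw [← Nat.mul_factorial_pred h0.ne']
        have : (α 0 : ℂ) ≠ 0 := by exact_mod_cast h0.ne'
        push_cast
        field_simp
    · have h := taylorCoeff_coord_mul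
        (differentiable_comp_cons_zero (differentiable_iterate_dz hf 0 (α 0))) j (Fin.tail α)
      have ht : Fin.tail (α - Pi.single j.succ 1) = Fin.tail α - Pi.single j 1 := by
        ext i; simp [Fin.tail, Pi.single_apply]
      have h0 : (α - Pi.single j.succ 1 : Fin (n + 1) → ℕ) 0 = α 0 := by simp
      simp only [taylorCoeff]
      rw [h0, ht, iterate_dz_coord_mul_of_ne hf (Fin.succ_ne_zero j).symm]
      simp only [Fin.cons_succ]
      rw [h]
      rw [mul_ite, mul_zero]
      rfl

theorem taylorCoeff_zero : ∀ {n : ℕ} (f : (Fin n → ℂ) → ℂ), taylorCoeff n f 0 = f 0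
  | 0, _ => rfl
  | n + 1, f => by
    have h := taylorCoeff_zero fun w : Fin n → ℂ => f (Fin.cons 0 w)
    have ht : Fin.tail (0 : Fin (n + 1) → ℕ) = 0 := rfl
    have hc : (Fin.cons 0 (0 : Fin n → ℂ) : Fin (n + 1) → ℂ) = 0 := by
      ext i; refine Fin.cases ?_ (fun j => ?_) i <;> simp
    simp only [taylorCoeff, ht, Pi.zero_apply, Function.iterate_zero, id, h, hc]
    simp

theorem taylorCoeff_one {n : ℕ} (α : Fin n → ℕ) :
    taylorCoeff n (fun _ => 1) α = if α = 0 then 1 else 0 := by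
  split_ifs with h
  · rw [h, taylorCoeff_zero]
  · obtain ⟨k, hk⟩ := Function.ne_iff.1 h
    obtain ⟨m, hm⟩ := Nat.exists_eq_succ_of_ne_zero hk
    -- A coefficient with α_k ≠ 0 is a nonzero multiple of which a coefficient of ∂1/∂z_k = 0 is
    -- formed, hence vanishes.
    have hd : dz k (fun _ : Fin n → ℂ => (1 : ℂ)) = (0 : ℂ) • fun _ => (1 : ℂ) := by
      ext z; simp [dz]
    have h1 := taylorCoeff_dz (f := fun _ : Fin n → ℂ => (1 : ℂ)) (differentiable_const 1) k
      (α - Pi.single k 1)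
    have h2 : α - Pi.single k 1 + Pi.single k 1 = α := by
      ext i
      by_cases hi : i = k
      · subst hi; simp [hm]
      · simp [Pi.single_eq_of_ne hi]
    rw [h2, hd, taylorCoeff_const_smul (differentiable_const 1), zero_mul] at h1
    have h3 : (((α - Pi.single k 1 : Fin n → ℕ) k : ℂ) + 1) ≠ 0 :=
      Nat.cast_add_one_ne_zero _
    exact (mul_eq_zero.1 h1.symm).resolve_left h3

/-- Every multiindex is the exponent of an entire monomial. -/
theorem exists_taylorCoeff_eq_ite {n : ℕ} (β : Fin n → ℕ) : ∃ f : (Fin n → ℂ) → ℂ,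
    Differentiable ℂ f ∧ ∀ α, taylorCoeff n f α = if α = β then 1 else 0 := by
  -- Induction on the total degree: a monomial of positive degree is z_k times one of lower degree.
  obtain ⟨d, hd⟩ : ∃ d, ∑ i, β i = d := ⟨_, rfl⟩
  induction d generalizing β with
  | zero =>
    have : β = 0 := by
      ext i; exact Finset.sum_eq_zero_iff.1 hd i (Finset.mem_univ i)
    exact ⟨fun _ => 1, differentiable_const 1, fun α => by rw [this, taylorCoeff_one]⟩
  | succ d ih =>
    obtain ⟨k, -, hk⟩ : ∃ k ∈ Finset.univ, β k ≠ 0 := by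
      by_contra! h
      rw [Finset.sum_eq_zero h] at hd
      omega
    have h2 : β - Pi.single k 1 + Pi.single k 1 = β := by
      ext i
      by_cases hi : i = k
      · subst hi; simp; omega
      · simp [Pi.single_eq_of_ne hi]
    obtain ⟨f, hf, hc⟩ := ih (β - Pi.single k 1) (by
      have : ∑ i, (β - Pi.single k 1 + Pi.single k 1 : Fin n → ℕ) i = d + 1 := by rw [h2, hd]
      simp only [Pi.add_apply, Finset.sum_add_distrib, Finset.sum_pi_single', Finset.mem_univ,
        if_true] at this
      omega)
    refine ⟨fun z => z k * f z, differentiable_coord_mul hf k, fun α => ?_⟩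
    rw [taylorCoeff_coord_mul hf, hc]
    by_cases hα : α k = 0
    · have : α ≠ β := by rintro rfl; exact hk hα
      simp [hα, this]
    · rw [if_neg hα]
      congr 1
      refine propext ⟨fun h => ?_, fun h => by rw [h]⟩
      rw [← h2, ← h]
      ext i
      by_cases hi : i = k
      · subst hi; simp; omega
      · simp [Pi.single_eq_of_ne hi]

end Coefficients

/-! ### Parseval's identity in several variables. -/

section Parseval

open MeasureTheory

theorem iteratedDeriv_comp_cons {n : ℕ} {f : (Fin (n + 1) → ℂ) → ℂ} (hf : Differentiable ℂ f)
    (w : Fin n → ℂ) (m : ℕ) : iteratedDeriv m (fun x => f (Fin.cons x w)) =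
      fun x => (dz 0)^[m] f (Fin.cons x w) := by
  induction m with
  | zero => simp
  | succ m ih =>
    rw [iteratedDeriv_succ, ih, Function.iterate_succ_apply']
    ext x
    exact (hasDerivAt_comp_cons (differentiable_iterate_dz hf 0 m) w x).deriv

theorem FockSpace.weight_cons {n : ℕ} (x : ℂ) (w : Fin n → ℂ) :
    FockSpace.weight (Fin.cons x w : Fin (n + 1) → ℂ) =
      Real.exp (-‖x‖ ^ 2) * FockSpace.weight w := by
  simp only [FockSpace.weight, Fin.sum_univ_succ, Fin.cons_zero, Fin.cons_succ]
  rw [← Real.exp_add]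
  ring_nf

/-- Parseval's identity for entire functions, with values in `[0, ∞]`. -/
theorem lintegral_norm_sq_weight : ∀ {n : ℕ} {f : (Fin n → ℂ) → ℂ}, Differentiable ℂ f →
    ∫⁻ z, ENNReal.ofReal (‖f z‖ ^ 2 * FockSpace.weight z) =
      ∑' α, ENNReal.ofReal (monomialWeight α * ‖taylorCoeff n f α‖ ^ 2)
  | 0, f, _ => by
    rw [tsum_eq_single 0 fun α hα => absurd (Subsingleton.elim α 0) hα]
    have h : ∀ z : Fin 0 → ℂ, z = 0 := fun z => Subsingleton.elim _ _
    simp_rw [h, lintegral_const, taylorCoeff, monomialWeight, FockSpace.weight]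
    simp [volume_pi]
  | n + 1, f, hf => by
    have hfc := hf.continuous
    have hwc := FockSpace.continuous_weight (n := n + 1)
    have hcons : Continuous fun p : ℂ × (Fin n → ℂ) => (Fin.cons p.1 p.2 : Fin (n + 1) → ℂ) :=
      continuous_pi fun i => by
        refine Fin.cases ?_ (fun j => ?_) i
        · simpa using continuous_fst
        · exact (continuous_apply j).comp continuous_snd
    have hmeas : Measurable fun p : ℂ × (Fin n → ℂ) => ENNReal.ofReal
        (‖f (Fin.cons p.1 p.2)‖ ^ 2 * FockSpace.weight (Fin.cons p.1 p.2 : Fin (n + 1) → ℂ)) :=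
      ENNReal.measurable_ofReal.comp
        (((hfc.comp hcons).norm.pow 2).mul (hwc.comp hcons)).measurable
    have h1 : ∫⁻ z, ENNReal.ofReal (‖f z‖ ^ 2 * FockSpace.weight z) =
        ∫⁻ p : ℂ × (Fin n → ℂ), ENNReal.ofReal (‖f (Fin.cons p.1 p.2)‖ ^ 2 *
          FockSpace.weight (Fin.cons p.1 p.2 : Fin (n + 1) → ℂ)) := by
      rw [← (volume_preserving_piFinSuccAbove (fun _ : Fin (n + 1) => ℂ) 0).symm.lintegral_comp_emb
        (MeasurableEquiv.measurableEmbedding _)]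
      refine lintegral_congr fun p => ?_
      have : (MeasurableEquiv.piFinSuccAbove (fun _ : Fin (n + 1) => ℂ) 0).symm p =
          Fin.cons p.1 p.2 := by
        simp [MeasurableEquiv.piFinSuccAbove, Fin.insertNthEquiv]
      rw [this]
    -- Parseval in z_0 for fixed w; the resulting coefficients are entire in w, so the induction
    -- hypothesis applies to them. In [0, ∞] Tonelli and the exchange of sum and integral need no
    -- finiteness.
    have h2 : ∀ w : Fin n → ℂ, ∫⁻ x : ℂ, ENNReal.ofReal (‖f (Fin.cons x w)‖ ^ 2 *
        FockSpace.weight (Fin.cons x w : Fin (n + 1) → ℂ)) =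
        ∑' m : ℕ, ENNReal.ofReal (Real.pi * m.factorial) *
          ENNReal.ofReal (‖(m.factorial : ℂ)⁻¹‖ ^ 2) *
          ENNReal.ofReal (‖(dz 0)^[m] f (Fin.cons 0 w)‖ ^ 2 * FockSpace.weight w) := by
      intro w
      have hg : Differentiable ℂ fun x => f (Fin.cons x w) := fun x =>
        (hasDerivAt_comp_cons hf w x).differentiableAt
      have h3 : ∀ x : ℂ, ENNReal.ofReal (‖f (Fin.cons x w)‖ ^ 2 *
          FockSpace.weight (Fin.cons x w : Fin (n + 1) → ℂ)) =
          ENNReal.ofReal (‖f (Fin.cons x w)‖ ^ 2 * Real.exp (-‖x‖ ^ 2)) *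
            ENNReal.ofReal (FockSpace.weight w) := fun x => by
        rw [FockSpace.weight_cons, ← mul_assoc, ENNReal.ofReal_mul (by positivity)]
      simp_rw [h3]
      rw [lintegral_mul_const' _ _ ENNReal.ofReal_ne_top, lintegral_norm_sq_gaussian_one hg,
        ← ENNReal.tsum_mul_right]
      refine tsum_congr fun m => ?_
      rw [iteratedDeriv_comp_cons hf, norm_mul, mul_pow,
        ENNReal.ofReal_mul (p := ‖(m.factorial : ℂ)⁻¹‖ ^ 2) (by positivity),
        ENNReal.ofReal_mul (p := ‖(dz 0)^[m] f (Fin.cons 0 w)‖ ^ 2) (by positivity)]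
      ring
    rw [h1, Measure.volume_eq_prod, lintegral_prod_symm _ hmeas.aemeasurable]
    simp_rw [h2]
    rw [lintegral_tsum]
    · rw [← (Fin.consEquiv fun _ : Fin (n + 1) => ℕ).tsum_eq, ENNReal.tsum_prod']
      refine tsum_congr fun m => ?_
      rw [lintegral_const_mul' _ _ (ENNReal.mul_ne_top ENNReal.ofReal_ne_top
        ENNReal.ofReal_ne_top), lintegral_norm_sq_weight
        (differentiable_comp_cons_zero (differentiable_iterate_dz hf 0 m)),
        ← ENNReal.tsum_mul_left]
      refine tsum_congr fun α => ?_
      rw [← ENNReal.ofReal_mul (by positivity), ← ENNReal.ofReal_mul (by positivity)]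
      congr 1
      have ht : Fin.tail (Fin.consEquiv (fun _ : Fin (n + 1) => ℕ) (m, α)) = α := rfl
      simp only [ht, Fin.consEquiv_apply, monomialWeight, Fin.prod_univ_succ, taylorCoeff,
        Fin.cons_zero, Fin.cons_succ, norm_mul, mul_pow]
      ring
    · intro m
      have hd := (differentiable_comp_cons_zero (differentiable_iterate_dz hf 0 m)).continuous
      have hw := FockSpace.continuous_weight (n := n)
      exact (measurable_const.mul (ENNReal.measurable_ofReal.comp
        ((hd.norm.pow 2).mul hw).measurable)).aemeasurable

variable {n : ℕ}

/-- Parseval in [0, ∞] presupposes only that f is entire, so both sides of it are finite together.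
-/
theorem FockSpace.mem_iff_summable {f : (Fin n → ℂ) → ℂ} (hf : Differentiable ℂ f) :
    FockSpace.Mem f ↔ Summable fun α => monomialWeight α * ‖taylorCoeff n f α‖ ^ 2 := by
  have hc : Continuous fun z => ‖f z‖ ^ 2 * FockSpace.weight z :=
    (hf.continuous.norm.pow 2).mul FockSpace.continuous_weight
  have h0 : ∀ z, 0 ≤ ‖f z‖ ^ 2 * FockSpace.weight z := fun z =>
    mul_nonneg (by positivity) (FockSpace.weight_pos z).le
  have h1 : ∀ α, 0 ≤ monomialWeight α * ‖taylorCoeff n f α‖ ^ 2 := fun α =>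
    mul_nonneg (monomialWeight_pos α).le (by positivity)
  rw [FockSpace.Mem, and_iff_right hf]
  constructor
  · intro hi
    have h2 := (hasFiniteIntegral_iff_ofReal (Filter.Eventually.of_forall h0)).1 hi.2
    rw [lintegral_norm_sq_weight hf] at h2
    have h3 := ENNReal.summable_toReal h2.ne
    simpa only [ENNReal.toReal_ofReal (h1 _)] using h3
  · intro hs
    refine ⟨hc.aestronglyMeasurable,
      (hasFiniteIntegral_iff_ofReal (Filter.Eventually.of_forall h0)).2 ?_⟩
    rw [lintegral_norm_sq_weight hf, ← ENNReal.ofReal_tsum_of_nonneg h1 hs]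
    exact ENNReal.ofReal_lt_top

/-- Parseval's identity in the Fock space. -/
theorem FockSpace.Mem.hasSum_norm_sq {f : (Fin n → ℂ) → ℂ} (hf : FockSpace.Mem f) :
    HasSum (fun α => monomialWeight α * ‖taylorCoeff n f α‖ ^ 2)
      (∫ z, ‖f z‖ ^ 2 * FockSpace.weight z) := by
  have h0 : ∀ z, 0 ≤ ‖f z‖ ^ 2 * FockSpace.weight z := fun z =>
    mul_nonneg (by positivity) (FockSpace.weight_pos z).le
  have h1 : ∀ α, 0 ≤ monomialWeight α * ‖taylorCoeff n f α‖ ^ 2 := fun α =>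
    mul_nonneg (monomialWeight_pos α).le (by positivity)
  have hs := (FockSpace.mem_iff_summable hf.1).1 hf
  have h2 := lintegral_norm_sq_weight hf.1
  rw [← ofReal_integral_eq_lintegral_ofReal hf.2 (Filter.Eventually.of_forall h0),
    ← ENNReal.ofReal_tsum_of_nonneg h1 hs,
    ENNReal.ofReal_eq_ofReal_iff (integral_nonneg h0) (tsum_nonneg h1)] at h2
  rw [h2]
  exact hs.hasSum

end Parseval

/-! ### The Fock space as a Hilbert space, isometric to ℓ². -/

namespace Fock

open MeasureTheory Filter Topology

variable {n : ℕ}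

theorem norm_sq_eq_integral (f : Fock n) :
    ‖f‖ ^ 2 = ∫ z, ‖f z‖ ^ 2 * FockSpace.weight z := by
  have h : (fun z => conj (f z) * f z * (FockSpace.weight z : ℂ))
      = fun z => ((‖f z‖ ^ 2 * FockSpace.weight z : ℝ) : ℂ) := by
    ext z
    rw [Complex.conj_mul']
    push_cast
    ring
  have h1 : inner ℂ f f = ∫ z, conj (f z) * f z * (FockSpace.weight z : ℂ) := rfl
  rw [h, integral_complex_ofReal, inner_self_eq_norm_sq_to_K] at h1
  exact Complex.ofReal_injective (by simpa using h1)

theorem ofReal_norm_sq (f : Fock n) :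
    ENNReal.ofReal (‖f‖ ^ 2) = ∫⁻ z, ENNReal.ofReal (‖f z‖ ^ 2 * FockSpace.weight z) := by
  rw [norm_sq_eq_integral]
  exact ofReal_integral_eq_lintegral_ofReal f.mem.2
    (Eventually.of_forall fun z => mul_nonneg (by positivity) (FockSpace.weight_pos z).le)

theorem hasSum_norm_sq (f : Fock n) :
    HasSum (fun α => monomialWeight α * ‖taylorCoeff n f α‖ ^ 2) (‖f‖ ^ 2) := by
  rw [norm_sq_eq_integral]
  exact f.mem.hasSum_norm_sq

/-- Point evaluations on the Fock space are bounded. -/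
theorem norm_apply_sq_le (f : Fock n) (w : Fin n → ℂ) :
    Real.pi ^ n * (‖f w‖ ^ 2 * FockSpace.weight w) ≤ ‖f‖ ^ 2 := by
  set S : ℝ := ∑ i, ‖w i‖ ^ 2
  -- The Weyl translate of f: the exponential factor is chosen so that |g|² e^{-|z|²} is the
  -- translate of |f|² e^{-|z|²}. Thus g has the norm of f, and evaluation at w becomes the zeroth
  -- Taylor coefficient of g up to a factor.
  let g : (Fin n → ℂ) → ℂ := fun z => f (z + w) * Complex.exp (-(∑ i, z i * conj (w i)) - S / 2)
  have hg : Differentiable ℂ g := by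
    have h1 : Differentiable ℂ fun z : Fin n → ℂ => f (z + w) :=
      f.mem.1.comp (differentiable_id.add_const w)
    have h2 : Differentiable ℂ fun z : Fin n → ℂ =>
        Complex.exp (-(∑ i, z i * conj (w i)) - S / 2) := by fun_prop
    exact h1.mul h2
  have hgw : ∀ z, ‖g z‖ ^ 2 * FockSpace.weight z =
      ‖f (z + w)‖ ^ 2 * FockSpace.weight (z + w) := by
    intro z
    have h3 : ∀ i, ‖z i + w i‖ ^ 2 = ‖z i‖ ^ 2 + 2 * (z i * conj (w i)).re + ‖w i‖ ^ 2 := by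
      intro i
      rw [← Complex.normSq_eq_norm_sq, ← Complex.normSq_eq_norm_sq, ← Complex.normSq_eq_norm_sq,
        Complex.normSq_add]
      ring
    simp only [g, norm_mul, Complex.norm_exp, mul_pow, FockSpace.weight]
    rw [mul_assoc, ← Real.exp_nat_mul, ← Real.exp_add]
    congr 2
    simp only [Pi.add_apply, h3, Finset.sum_add_distrib, ← Finset.mul_sum, Complex.sub_re,
      Complex.neg_re, Complex.re_sum, S]
    rw [show ((∑ i, ‖w i‖ ^ 2 : ℝ) : ℂ) / 2 = ((∑ i, ‖w i‖ ^ 2) / 2 : ℝ) by push_cast; rfl,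
      Complex.ofReal_re]
    push_cast
    ring
  have hmem : FockSpace.Mem g := by
    refine ⟨hg, ?_⟩
    simp_rw [hgw]
    exact f.mem.2.comp_add_right w
  have hint : ∫ z, ‖g z‖ ^ 2 * FockSpace.weight z = ‖f‖ ^ 2 := by
    simp_rw [hgw]
    rw [norm_sq_eq_integral, integral_add_right_eq_self
      (fun z => ‖f z‖ ^ 2 * FockSpace.weight z)]
  have h := le_hasSum hmem.hasSum_norm_sq 0 fun α _ =>
    mul_nonneg (monomialWeight_pos α).le (by positivity)
  rw [hint, taylorCoeff_zero] at h
  refine le_trans (le_of_eq ?_) h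
  have h4 : ‖g 0‖ ^ 2 = ‖f w‖ ^ 2 * FockSpace.weight w := by
    have := hgw 0
    simpa [FockSpace.weight] using this
  rw [h4]
  simp [monomialWeight]

/-- Norm convergence in the Fock space controls uniform convergence on balls. -/
theorem exists_norm_apply_le (R : ℝ) :
    ∃ C : ℝ, 0 < C ∧ ∀ f : Fock n, ∀ z ∈ Metric.ball (0 : Fin n → ℂ) R, ‖f z‖ ≤ C * ‖f‖ := by
  have hpi : (0 : ℝ) < Real.pi ^ n := by positivity
  -- Balls here are taken in the sup norm, so |z|² is bounded by n R² rather than R².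
  let D : ℝ := Real.exp (n * R ^ 2) / Real.pi ^ n
  have hD : 0 < D := by positivity
  refine ⟨√D, Real.sqrt_pos.2 hD, fun f z hz => ?_⟩
  have h1 := norm_apply_sq_le f z
  have hR : ‖z‖ < R := mem_ball_zero_iff.1 hz
  have h2 : Real.exp (-(n * R ^ 2)) ≤ FockSpace.weight z := by
    refine Real.exp_le_exp.2 (neg_le_neg ?_)
    calc ∑ i, ‖z i‖ ^ 2 ≤ ∑ _i : Fin n, R ^ 2 := Finset.sum_le_sum fun i _ =>
          pow_le_pow_left₀ (norm_nonneg _) ((norm_le_pi_norm z i).trans hR.le) 2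
      _ = n * R ^ 2 := by simp
  have h3 : ‖f z‖ ^ 2 ≤ D * ‖f‖ ^ 2 := by
    have h4 : Real.pi ^ n * (‖f z‖ ^ 2 * Real.exp (-(n * R ^ 2))) ≤ ‖f‖ ^ 2 := by
      refine le_trans ?_ h1
      gcongr
    have h5 : ‖f z‖ ^ 2 = D * (Real.pi ^ n * (‖f z‖ ^ 2 * Real.exp (-(n * R ^ 2)))) := by
      simp only [D]
      rw [Real.exp_neg]
      field_simp
    rw [h5]
    gcongr
  have h6 := Real.sqrt_le_sqrt h3
  rwa [Real.sqrt_sq (norm_nonneg _), Real.sqrt_mul hD.le, Real.sqrt_sq (norm_nonneg _)] at h6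

/-- Bounded point evaluations make a Cauchy sequence uniformly Cauchy on balls, so it has an entire
limit; Fatou's lemma then shows that the limit lies in the space and is attained in norm. -/
instance : CompleteSpace (Fock n) := by
  refine Metric.complete_of_cauchySeq_tendsto fun u hu => ?_
  have hR : ∀ R, UniformCauchySeqOn (fun j => (u j : (Fin n → ℂ) → ℂ)) atTop
      (Metric.ball 0 R) := by
    intro R
    obtain ⟨C, hC, hle⟩ := exists_norm_apply_le (n := n) R
    rw [Metric.uniformCauchySeqOn_iff]
    intro ε hε
    obtain ⟨N, hN⟩ := Metric.cauchySeq_iff.1 hu (ε / C) (by positivity)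
    refine ⟨N, fun i hi j hj z hz => ?_⟩
    have h1 := hN i hi j hj
    rw [dist_eq_norm] at h1 ⊢
    refine (hle (u i - u j) z hz).trans_lt ?_
    rwa [lt_div_iff₀' hC] at h1
  have hl : ∀ z, ∃ l, Tendsto (fun j => u j z) atTop (𝓝 l) := fun z =>
    cauchySeq_tendsto_of_complete ((hR (‖z‖ + 1)).cauchySeq (by simp))
  choose F hF using hl
  have hFd : Differentiable ℂ F := Differentiable.of_tendstoUniformlyOn_ball
    (fun j => (u j).mem.1) fun R => (hR R).tendstoUniformlyOn_of_tendsto fun z _ => hF z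
  have hfatou : ∀ ε > 0, ∃ N, ∀ j ≥ N,
      ∫⁻ z, ENNReal.ofReal (‖F z - u j z‖ ^ 2 * FockSpace.weight z) ≤ ENNReal.ofReal (ε ^ 2) := by
    intro ε hε
    obtain ⟨N, hN⟩ := Metric.cauchySeq_iff.1 hu ε hε
    refine ⟨N, fun j hj => ?_⟩
    have h1 : ∀ z, ENNReal.ofReal (‖F z - u j z‖ ^ 2 * FockSpace.weight z) =
        liminf (fun i => ENNReal.ofReal (‖(u i - u j) z‖ ^ 2 * FockSpace.weight z)) atTop := by
      intro z
      refine (Tendsto.liminf_eq ?_).symm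
      exact (ENNReal.continuous_ofReal.tendsto _).comp
        ((((hF z).sub_const (u j z)).norm.pow 2).mul_const _)
    simp_rw [h1]
    refine (lintegral_liminf_le fun i => ?_).trans ?_
    · exact ENNReal.measurable_ofReal.comp (((u i - u j).mem.1.continuous.norm.pow 2).mul
        FockSpace.continuous_weight).measurable
    · refine liminf_le_of_frequently_le' (Eventually.frequently ?_)
      filter_upwards [eventually_ge_atTop N] with i hi
      rw [← ofReal_norm_sq]
      refine ENNReal.ofReal_le_ofReal (pow_le_pow_left₀ (norm_nonneg _) ?_ 2)
      rw [← dist_eq_norm]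
      exact (hN i hi j hj).le
  have hmem : ∀ j, ∫⁻ z, ENNReal.ofReal (‖F z - u j z‖ ^ 2 * FockSpace.weight z) < ⊤ →
      FockSpace.Mem fun z => F z - u j z := fun j hj => by
    have hd : Differentiable ℂ fun z => F z - u j z := hFd.sub (u j).mem.1
    refine ⟨hd, ((hd.continuous.norm.pow 2).mul FockSpace.continuous_weight).aestronglyMeasurable,
      (hasFiniteIntegral_iff_ofReal (Eventually.of_forall fun z =>
        mul_nonneg (by positivity) (FockSpace.weight_pos z).le)).2 hj⟩
  have hFm : FockSpace.Mem F := by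
    obtain ⟨N, hN⟩ := hfatou 1 one_pos
    have h1 := (hmem N ((hN N le_rfl).trans_lt ENNReal.ofReal_lt_top)).add (u N).mem
    have h2 : ((fun z => F z - u N z) + (u N).toFun) = F := by ext z; simp
    rwa [h2] at h1
  refine ⟨mk F hFm, Metric.tendsto_atTop.2 fun ε hε => ?_⟩
  obtain ⟨N, hN⟩ := hfatou (ε / 2) (by positivity)
  refine ⟨N, fun j hj => ?_⟩
  have h1 : ENNReal.ofReal (‖mk F hFm - u j‖ ^ 2) ≤ ENNReal.ofReal ((ε / 2) ^ 2) := by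
    rw [ofReal_norm_sq]
    exact hN j hj
  rw [ENNReal.ofReal_le_ofReal_iff (by positivity)] at h1
  rw [dist_comm, dist_eq_norm]
  linarith [(pow_le_pow_iff_left₀ (norm_nonneg _) (by positivity) two_ne_zero).1 h1]

theorem taylorCoeff_add (f g : Fock n) (α : Fin n → ℕ) :
    taylorCoeff n (f + g : Fock n) α = taylorCoeff n f α + taylorCoeff n g α :=
  _root_.taylorCoeff_add f.mem.1 g.mem.1 α

theorem taylorCoeff_smul (c : ℂ) (f : Fock n) (α : Fin n → ℕ) :
    taylorCoeff n (c • f : Fock n) α = c * taylorCoeff n f α :=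
  taylorCoeff_const_smul f.mem.1 c α

theorem taylorCoeff_sub (f g : Fock n) (α : Fin n → ℕ) :
    taylorCoeff n (f - g : Fock n) α = taylorCoeff n f α - taylorCoeff n g α := by
  rw [eq_sub_iff_add_eq, ← taylorCoeff_add, sub_add_cancel]

theorem ext_taylorCoeff {f g : Fock n} (h : ∀ α, taylorCoeff n f α = taylorCoeff n g α) :
    f = g := by
  have h1 := hasSum_norm_sq (f - g)
  simp_rw [taylorCoeff_sub, h, sub_self] at h1
  have h2 : ‖f - g‖ ^ 2 = 0 := h1.unique (by simp)
  exact sub_eq_zero.1 (norm_eq_zero.1 (pow_eq_zero_iff two_ne_zero |>.1 h2))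

theorem memℓp_sqrt_monomialWeight_mul {a : (Fin n → ℕ) → ℂ}
    (ha : Summable fun α => monomialWeight α * ‖a α‖ ^ 2) :
    Memℓp (fun α => (√(monomialWeight α) : ℂ) * a α) 2 := by
  refine memℓp_gen (ha.congr fun α => ?_)
  simp [mul_pow, Real.sq_sqrt (monomialWeight_pos α).le, abs_of_nonneg (Real.sqrt_nonneg _)]

/-- The normalized Taylor coefficients, as an isometry into `ℓ²`. -/
def toLp : Fock n →ₗᵢ[ℂ] lp (fun _ : Fin n → ℕ => ℂ) 2 where
  toFun f := ⟨fun α => (√(monomialWeight α) : ℂ) * taylorCoeff n f α,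
    memℓp_sqrt_monomialWeight_mul (hasSum_norm_sq f).summable⟩
  map_add' f g := by
    ext α
    simp only [taylorCoeff_add, mul_add]
    rfl
  map_smul' c f := by
    ext α
    simp [taylorCoeff_smul, mul_left_comm]
  norm_map' f := by
    have h1 := lp.hasSum_norm (p := 2) (by norm_num) (⟨_, memℓp_sqrt_monomialWeight_mul
      (hasSum_norm_sq f).summable⟩ : lp (fun _ : Fin n → ℕ => ℂ) 2)
    have h2 := hasSum_norm_sq f
    simp only [ENNReal.toReal_ofNat, Real.rpow_two, norm_mul, mul_pow, Complex.norm_real,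
      Real.norm_eq_abs, abs_of_nonneg (Real.sqrt_nonneg _),
      Real.sq_sqrt (monomialWeight_pos _).le] at h1
    exact (pow_left_inj₀ (norm_nonneg _) (norm_nonneg _) two_ne_zero).1 (h1.unique h2)

theorem toLp_apply (f : Fock n) (α : Fin n → ℕ) :
    toLp f α = (√(monomialWeight α) : ℂ) * taylorCoeff n f α := rfl

/-- Polarized Parseval: a linear isometry preserves inner products. -/
theorem hasSum_inner (f g : Fock n) :
    HasSum (fun α => (monomialWeight α : ℂ) * (conj (taylorCoeff n f α) * taylorCoeff n g α))
      (inner ℂ f g) := by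
  have h := lp.hasSum_inner (𝕜 := ℂ) (toLp f) (toLp g)
  rw [LinearIsometry.inner_map_map] at h
  have h1 : ∀ α, inner ℂ (toLp f α) (toLp g α) =
      (monomialWeight α : ℂ) * (conj (taylorCoeff n f α) * taylorCoeff n g α) := fun α => by
    have h2 : (√(monomialWeight α) : ℂ) * √(monomialWeight α) = monomialWeight α := by
      exact_mod_cast Real.mul_self_sqrt (monomialWeight_pos α).le
    rw [toLp_apply, toLp_apply, RCLike.inner_apply, ← h2]
    simp only [map_mul, Complex.conj_ofReal]
    ring
  simpa only [h1] using h

/-- The range is closed because the Fock space is complete, and it contains the unit vectors, which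
come from monomials and span a dense subspace. -/
theorem toLp_surjective : Function.Surjective (toLp (n := n)) := by
  classical
  have hclosed : IsClosed (Set.range (toLp (n := n))) :=
    toLp.isometry.isClosedEmbedding.isClosed_range
  have hsingle : ∀ (α : Fin n → ℕ) (a : ℂ),
      lp.single 2 α a ∈ LinearMap.range (toLp (n := n)).toLinearMap := by
    intro β a
    obtain ⟨f, hf, hc⟩ := exists_taylorCoeff_eq_ite β
    have hm : FockSpace.Mem f := by
      rw [FockSpace.mem_iff_summable hf]
      refine summable_of_ne_finset_zero (s := {β}) fun α hα => ?_
      rw [hc, if_neg (by simpa using hα)]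
      simp
    have h0 : (√(monomialWeight β) : ℂ) ≠ 0 := by
      exact_mod_cast (Real.sqrt_pos.2 (monomialWeight_pos β)).ne'
    refine ⟨(a / √(monomialWeight β) : ℂ) • mk f hm, ?_⟩
    ext α
    change toLp _ α = _
    rw [toLp_apply, taylorCoeff_smul]
    change _ * (_ * taylorCoeff n f α) = _
    rw [hc, lp.single_apply]
    by_cases h : α = β
    · subst h
      simp
      field_simp
    · simp [h]
  intro a
  have h1 := lp.hasSum_single (p := 2) (by norm_num) a
  have h2 : a ∈ closure (Set.range (toLp (n := n))) := by
    refine mem_closure_of_tendsto h1 (Eventually.of_forall fun s => ?_)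
    exact Submodule.sum_mem (LinearMap.range (toLp (n := n)).toLinearMap)
      fun α _ => hsingle α (a α)
  rwa [hclosed.closure_eq] at h2

/-- The Riesz–Fischer statement through which multiplier operators are constructed. -/
theorem exists_taylorCoeff {a : (Fin n → ℕ) → ℂ}
    (ha : Summable fun α => monomialWeight α * ‖a α‖ ^ 2) :
    ∃ f : Fock n, ∀ α, taylorCoeff n f α = a α := by
  obtain ⟨f, hf⟩ := toLp_surjective (n := n) ⟨_, memℓp_sqrt_monomialWeight_mul ha⟩
  refine ⟨f, fun α => ?_⟩
  have h1 : toLp f α = (√(monomialWeight α) : ℂ) * a α := by rw [hf]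
  rw [toLp_apply] at h1
  have h0 : (√(monomialWeight α) : ℂ) ≠ 0 := by
    exact_mod_cast (Real.sqrt_pos.2 (monomialWeight_pos α)).ne'
  exact mul_left_cancel₀ h0 h1

end Fock

/-! ### A scale of regularity measured by powers of the degree. -/

section Order

variable {n : ℕ}

/-- An entire function `f` has order `s` if `(|α| + 1) ^ s ‖c_α z ^ α‖ ^ 2` is summable, where the
`c_α` are the Taylor coefficients of `f`. The functions of order `0` form the Fock space. -/
def FockSpace.MemOrder (s : ℕ) (f : (Fin n → ℂ) → ℂ) : Prop :=
  Differentiable ℂ f ∧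
    Summable fun α => ((∑ i, α i : ℕ) + 1 : ℝ) ^ s * (monomialWeight α * ‖taylorCoeff n f α‖ ^ 2)

theorem monomialWeight_mul_nonneg (α : Fin n → ℕ) (c : ℂ) : 0 ≤ monomialWeight α * ‖c‖ ^ 2 :=
  mul_nonneg (monomialWeight_pos α).le (by positivity)

theorem sum_add_single (α : Fin n → ℕ) (k : Fin n) :
    ∑ i, (α + Pi.single k 1 : Fin n → ℕ) i = ∑ i, α i + 1 := by
  simp [Finset.sum_add_distrib]

theorem add_single_injective (k : Fin n) :
    Function.Injective fun α : Fin n → ℕ => α + Pi.single k 1 := add_left_injective _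

theorem sub_single_add_single {α : Fin n → ℕ} {k : Fin n} (hk : α k ≠ 0) :
    α - Pi.single k 1 + Pi.single k 1 = α := by
  ext i
  by_cases hi : i = k
  · subst hi; simp; omega
  · simp [Pi.single_eq_of_ne hi]

theorem eq_zero_of_notMem_range_add_single {α : Fin n → ℕ} {k : Fin n}
    (h : α ∉ Set.range fun α : Fin n → ℕ => α + Pi.single k 1) : α k = 0 := by
  by_contra hk
  exact h ⟨_, sub_single_add_single hk⟩

theorem taylorCoeff_sum {ι : Type*} (s : Finset ι) {f : ι → (Fin n → ℂ) → ℂ}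
    (hf : ∀ i, Differentiable ℂ (f i)) (α : Fin n → ℕ) :
    taylorCoeff n (∑ i ∈ s, f i) α = ∑ i ∈ s, taylorCoeff n (f i) α := by
  classical
  induction s using Finset.induction_on with
  | empty =>
    have := taylorCoeff_const_smul (differentiable_const (0 : ℂ) : Differentiable ℂ
      (fun _ : Fin n → ℂ => (0 : ℂ))) 0 α
    rw [zero_smul, zero_mul] at this
    simpa using this
  | insert i s hi ih =>
    rw [Finset.sum_insert hi, Finset.sum_insert hi, taylorCoeff_add (hf i)
      (Differentiable.sum fun i _ => hf i), ih]

namespace FockSpace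

theorem memOrder_zero_iff {f : (Fin n → ℂ) → ℂ} : MemOrder 0 f ↔ Mem f := by
  constructor
  · intro h
    rw [mem_iff_summable h.1]
    simpa using h.2
  · intro h
    exact ⟨h.1, by simpa using (mem_iff_summable h.1).1 h⟩

theorem MemOrder.mono {s t : ℕ} (hst : s ≤ t) {f : (Fin n → ℂ) → ℂ} (hf : MemOrder t f) :
    MemOrder s f := by
  refine ⟨hf.1, Summable.of_nonneg_of_le (fun α => mul_nonneg (by positivity)
    (monomialWeight_mul_nonneg _ _)) (fun α => ?_) hf.2⟩
  refine mul_le_mul_of_nonneg_right (pow_le_pow_right₀ ?_ hst) (monomialWeight_mul_nonneg _ _)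
  have : (0 : ℝ) ≤ (∑ i, α i : ℕ) := Nat.cast_nonneg _
  linarith

theorem MemOrder.mem {s : ℕ} {f : (Fin n → ℂ) → ℂ} (hf : MemOrder s f) : Mem f :=
  memOrder_zero_iff.1 (hf.mono (Nat.zero_le s))

theorem MemOrder.add {s : ℕ} {f g : (Fin n → ℂ) → ℂ} (hf : MemOrder s f) (hg : MemOrder s g) :
    MemOrder s (f + g) := by
  refine ⟨hf.1.add hg.1, Summable.of_nonneg_of_le (fun α => mul_nonneg (by positivity)
    (monomialWeight_mul_nonneg _ _)) (fun α => ?_) ((hf.2.add hg.2).mul_left 2)⟩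
  rw [taylorCoeff_add hf.1 hg.1, ← mul_add, ← mul_add, mul_left_comm, mul_left_comm (2 : ℝ)]
  have h1 := norm_add_le (taylorCoeff n f α) (taylorCoeff n g α)
  have h2 : ‖taylorCoeff n f α + taylorCoeff n g α‖ ^ 2 ≤
      2 * (‖taylorCoeff n f α‖ ^ 2 + ‖taylorCoeff n g α‖ ^ 2) := by
    nlinarith [sq_nonneg (‖taylorCoeff n f α‖ - ‖taylorCoeff n g α‖),
      norm_nonneg (taylorCoeff n f α + taylorCoeff n g α)]
  have h3 := (monomialWeight_pos α).le
  calc _ ≤ monomialWeight α * (((∑ i, α i : ℕ) + 1 : ℝ) ^ s *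
        (2 * (‖taylorCoeff n f α‖ ^ 2 + ‖taylorCoeff n g α‖ ^ 2))) := by gcongr
    _ = _ := by ring

theorem MemOrder.smul {s : ℕ} {f : (Fin n → ℂ) → ℂ} (c : ℂ) (hf : MemOrder s f) :
    MemOrder s (c • f) := by
  refine ⟨hf.1.const_smul c, (hf.2.mul_left (‖c‖ ^ 2)).congr fun α => ?_⟩
  rw [taylorCoeff_const_smul hf.1, norm_mul]
  ring

theorem MemOrder.zero {s : ℕ} : MemOrder s (0 : (Fin n → ℂ) → ℂ) := by
  have h : ∀ α, taylorCoeff n (0 : (Fin n → ℂ) → ℂ) α = 0 := fun α => by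
    simpa using taylorCoeff_sum (∅ : Finset ℕ) (f := fun _ => (0 : (Fin n → ℂ) → ℂ))
      (fun _ => differentiable_const 0) α
  exact ⟨differentiable_const 0, by simp [h]⟩

theorem MemOrder.sum {s : ℕ} {ι : Type*} (t : Finset ι) {f : ι → (Fin n → ℂ) → ℂ}
    (hf : ∀ i, MemOrder s (f i)) : MemOrder s (∑ i ∈ t, f i) :=
  Finset.sum_induction _ _ (fun _ _ => MemOrder.add) MemOrder.zero fun i _ => hf i

/-- Differentiation produces (α_k + 1)². One factor is absorbed by the change of weight from α to α
+ e_k; the other costs one order. -/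
theorem MemOrder.dz {s : ℕ} {f : (Fin n → ℂ) → ℂ} (hf : MemOrder (s + 1) f) (k : Fin n) :
    MemOrder s (dz k f) := by
  refine ⟨differentiable_dz hf.1 k, Summable.of_nonneg_of_le (fun α => mul_nonneg (by positivity)
    (monomialWeight_mul_nonneg _ _)) (fun α => ?_) (hf.2.comp_injective (add_single_injective k))⟩
  have hk : α k ≤ ∑ i, α i := Finset.single_le_sum (fun _ _ => Nat.zero_le _) (Finset.mem_univ k)
  have hk' : (α k : ℝ) ≤ (∑ i, α i : ℕ) := by exact_mod_cast hk
  have h3 := (monomialWeight_pos α).le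
  have hnn : ‖((α k : ℂ) + 1)‖ = α k + 1 := by
    exact_mod_cast Complex.norm_natCast (α k + 1)
  simp only [Function.comp_apply]
  rw [taylorCoeff_dz hf.1, sum_add_single, monomialWeight_add_single, norm_mul, hnn]
  push_cast at hk' ⊢
  set d : ℝ := ∑ i, (α i : ℝ)
  have hd : 0 ≤ d := Finset.sum_nonneg fun i _ => Nat.cast_nonneg _
  calc (d + 1) ^ s * (monomialWeight α * ((α k + 1) * ‖taylorCoeff n f (α + Pi.single k 1)‖) ^ 2)
      = ((d + 1) ^ s * (α k + 1)) * ((α k + 1) * monomialWeight α *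
        ‖taylorCoeff n f (α + Pi.single k 1)‖ ^ 2) := by ring
    _ ≤ ((d + 1 + 1) ^ s * (d + 1 + 1)) * ((α k + 1) * monomialWeight α *
        ‖taylorCoeff n f (α + Pi.single k 1)‖ ^ 2) := by
        gcongr <;> linarith
    _ = _ := by rw [pow_succ (d + 1 + 1) s]

/-- The weight grows by α_k + 1 under the shift, which costs one order; the constant 2^s accounts
for |α| + 2 ≤ 2(|α| + 1). -/
theorem MemOrder.coord_mul {s : ℕ} {f : (Fin n → ℂ) → ℂ} (hf : MemOrder (s + 1) f) (k : Fin n) :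
    MemOrder s fun z => z k * f z := by
  refine ⟨differentiable_coord_mul hf.1 k, ?_⟩
  rw [← (add_single_injective k).summable_iff]
  · refine Summable.of_nonneg_of_le (fun α => mul_nonneg (by positivity)
      (monomialWeight_mul_nonneg _ _)) (fun α => ?_) (hf.2.mul_left (2 ^ s))
    have hk : α k ≤ ∑ i, α i := Finset.single_le_sum (fun _ _ => Nat.zero_le _) (Finset.mem_univ k)
    have hk' : (α k : ℝ) ≤ (∑ i, α i : ℕ) := by exact_mod_cast hk
    have h3 := (monomialWeight_pos α).le
    simp only [Function.comp_apply]
    rw [taylorCoeff_coord_mul hf.1, sum_add_single, monomialWeight_add_single, add_tsub_cancel_right,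
      if_neg (by simp)]
    push_cast at hk' ⊢
    set d : ℝ := ∑ i, (α i : ℝ)
    have hd : 0 ≤ d := Finset.sum_nonneg fun i _ => Nat.cast_nonneg _
    calc (d + 1 + 1) ^ s * ((α k + 1) * monomialWeight α * ‖taylorCoeff n f α‖ ^ 2)
        ≤ (2 * (d + 1)) ^ s * ((d + 1) * monomialWeight α * ‖taylorCoeff n f α‖ ^ 2) := by
          gcongr
          linarith
      _ = _ := by rw [mul_pow, pow_succ]; ring
  · intro α hα
    rw [taylorCoeff_coord_mul hf.1, if_pos (eq_zero_of_notMem_range_add_single hα)]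
    simp

/-- Each derivative weighs the coefficients by α_k, so that summing over k gives the degree |α| in
the graph norm. -/
theorem hasSum_norm_sq_dz_iff {f : (Fin n → ℂ) → ℂ} (hf : Differentiable ℂ f) (k : Fin n) (S : ℝ) :
    HasSum (fun α => monomialWeight α * ‖taylorCoeff n (dz k f) α‖ ^ 2) S ↔
      HasSum (fun α => α k * (monomialWeight α * ‖taylorCoeff n f α‖ ^ 2)) S := by
  rw [← (add_single_injective k).hasSum_iff
    (f := fun α => α k * (monomialWeight α * ‖taylorCoeff n f α‖ ^ 2))]
  · refine iff_of_eq (congrArg (HasSum · S) (funext fun α => ?_))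
    have hnn : ‖((α k : ℂ) + 1)‖ = α k + 1 := by
      exact_mod_cast Complex.norm_natCast (α k + 1)
    simp only [Function.comp_apply]
    rw [taylorCoeff_dz hf, monomialWeight_add_single, norm_mul, hnn]
    simp
    ring
  · intro α hα
    rw [eq_zero_of_notMem_range_add_single hα]
    simp

end FockSpace

/-! ### Adjointness of z_k and ∂/∂z_k; monomials as test functions. -/

namespace Fock

/-- Multiplication by `z_k` is adjoint to `∂/∂z_k`. -/
theorem inner_dz_left (f g : Fock n) (k : Fin n) (hf : FockSpace.Mem (dz k f))
    (hg : FockSpace.Mem fun z => z k * g z) :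
    inner ℂ (mk _ hf) g = inner ℂ f (mk _ hg) := by
  refine (hasSum_inner _ g).unique ?_
  have h := hasSum_inner f (mk _ hg)
  rw [← (add_single_injective k).hasSum_iff] at h
  · refine (iff_of_eq (congrArg (HasSum · _) (funext fun α => ?_))).1 h
    change _ = (monomialWeight α : ℂ) * (conj (taylorCoeff n (dz k f) α) * taylorCoeff n g α)
    change (monomialWeight (α + Pi.single k 1) : ℂ) * (conj (taylorCoeff n f (α + Pi.single k 1)) *
      taylorCoeff n (fun z => z k * g z) (α + Pi.single k 1)) = _
    rw [taylorCoeff_dz f.mem.1, taylorCoeff_coord_mul g.mem.1, add_tsub_cancel_right,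
      if_neg (by simp), monomialWeight_add_single]
    simp
    ring
  · intro α hα
    change _ * (_ * taylorCoeff n (fun z => z k * g z) α) = 0
    rw [taylorCoeff_coord_mul g.mem.1, if_pos (eq_zero_of_notMem_range_add_single hα)]
    simp

theorem exists_monomial (β : Fin n → ℕ) :
    ∃ f : Fock n, ∀ α, taylorCoeff n f α = if α = β then 1 else 0 :=
  exists_taylorCoeff (summable_of_ne_finset_zero (s := {β}) fun α hα => by
    rw [if_neg (by simpa using hα)]; simp)

/-- The monomial `z ^ β`. -/
def monomial (β : Fin n → ℕ) : Fock n := (exists_monomial β).choose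

theorem taylorCoeff_monomial (β α : Fin n → ℕ) :
    taylorCoeff n (monomial β) α = if α = β then 1 else 0 := (exists_monomial β).choose_spec α

theorem memOrder_monomial (β : Fin n → ℕ) (s : ℕ) : FockSpace.MemOrder s (monomial β).toFun :=
  ⟨(monomial β).mem.1, summable_of_ne_finset_zero (s := {β}) fun α hα => by
    rw [taylorCoeff_monomial, if_neg (by simpa using hα)]; simp⟩

theorem inner_monomial_left (β : Fin n → ℕ) (g : Fock n) :
    inner ℂ (monomial β) g = monomialWeight β * taylorCoeff n g β := by
  refine (hasSum_inner _ g).unique ?_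
  convert hasSum_single β fun α hα => ?_ using 1
  · rw [taylorCoeff_monomial]; simp
  · rw [taylorCoeff_monomial, if_neg hα]; simp

/-- Here z_k g need not lie in the Fock space, so `inner_dz_left` does not apply; the single nonzero
coefficient of the monomial makes the pairing explicit. -/
theorem inner_dz_monomial_left (β : Fin n → ℕ) (g : Fock n) (k : Fin n)
    (h : FockSpace.Mem (dz k (monomial β))) :
    inner ℂ (mk _ h) g =
      monomialWeight β * (if β k = 0 then 0 else taylorCoeff n g (β - Pi.single k 1)) := by
  refine (hasSum_inner _ g).unique ?_
  have h1 : ∀ α, taylorCoeff n (mk _ h) α = (α k + 1) * if α + Pi.single k 1 = β then 1 else 0 :=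
    fun α => by
      rw [← taylorCoeff_monomial]
      exact taylorCoeff_dz (monomial β).mem.1 k α
  convert hasSum_single (β - Pi.single k 1) fun α hα => ?_ using 1
  · rw [h1]
    by_cases hk : β k = 0
    · rw [if_pos hk, if_neg]
      · simp
      · intro h2
        have := congrFun h2 k
        simp [hk] at this
    · rw [if_neg hk, sub_single_add_single hk]
      conv_lhs => rw [← sub_single_add_single hk, monomialWeight_add_single]
      simp
      ring
  · rw [h1, if_neg]
    · simp
    · intro h2
      exact hα (by rw [← h2, add_tsub_cancel_right])

end Fock

end Order

/-! ### The adjoint relation for densely defined operators. -/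

namespace HilbertComplex

variable {E F : Type*}
  [NormedAddCommGroup E] [InnerProductSpace ℂ E] [CompleteSpace E]
  [NormedAddCommGroup F] [InnerProductSpace ℂ F] {T : E →ₗ.[ℂ] F}

/-- Density of the domain identifies the graph definition `adj` with `LinearPMap.adjoint`. -/
theorem inner_adj_right (hT : Dense (T.domain : Set E)) (x : T.domain) (y : (adj T).domain) :
    inner ℂ (T x) (y : F) = inner ℂ (x : E) (adj T y) := by
  have h := LinearPMap.graph_adjoint_toLinearPMap_eq_adjoint hT
  change T.graph.adjoint.toLinearPMap = _ at h
  unfold adj at y ⊢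
  revert y
  rw [h]
  intro y
  exact (LinearPMap.adjoint_isFormalAdjoint hT).symm x y

theorem exists_adj_eq (hT : Dense (T.domain : Set E)) {y : F} {w : E}
    (h : ∀ x : T.domain, inner ℂ (T x) y = inner ℂ (x : E) w) :
    ∃ hy : y ∈ (adj T).domain, adj T ⟨y, hy⟩ = w := by
  have hadj : adj T = T.adjoint := LinearPMap.graph_adjoint_toLinearPMap_eq_adjoint hT
  have h' : ∀ x : T.domain, inner ℂ w (x : E) = inner ℂ y (T x) := fun x => by
    rw [← inner_conj_symm, ← h, inner_conj_symm]
  rw [hadj]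
  exact ⟨LinearPMap.mem_adjoint_domain_of_exists y ⟨w, h'⟩, LinearPMap.adjoint_apply_eq hT _ h'⟩

end HilbertComplex

theorem hasSum_prod_of_fintype {ι κ A : Type*} [Fintype ι] [AddCommMonoid A] [TopologicalSpace A]
    [ContinuousAdd A] {f : ι × κ → A} {a : ι → A} (h : ∀ i, HasSum (fun k => f (i, k)) (a i)) :
    HasSum f (∑ i, a i) := by
  classical
  have h1 : ∀ i, HasSum (fun x : ι × κ => if x.1 = i then f x else 0) (a i) := by
    intro i
    rw [← (Prod.mk_right_injective i).hasSum_iff]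
    · simpa [Function.comp_def] using h i
    · rintro ⟨j, k⟩ hj
      rw [if_neg]
      rintro rfl
      exact hj ⟨k, rfl⟩
  simpa using hasSum_sum (s := Finset.univ) fun i (_ : i ∈ Finset.univ) => h1 i

/-! ### Signs of exterior multiplication and the anticommutation relations. -/

section Wedge

variable {n p : ℕ}

/-- The coefficient of `dz_K` in `dz_k ∧ dz_J`. -/
def wedgeSign (k : Fin n) (J : MultiIdx n p) (K : MultiIdx n (p + 1)) : ℂ :=
  if k ∉ J.1 ∧ K.1 = insert k J.1 then (-1) ^ (J.1.filter (· < k)).card else 0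

theorem conj_wedgeSign (k : Fin n) (J : MultiIdx n p) (K : MultiIdx n (p + 1)) :
    conj (wedgeSign k J K) = wedgeSign k J K := by
  unfold wedgeSign
  split_ifs <;> simp

/-- Sums over all k and J with a sign matrix can be interchanged freely, and the adjoint is read off
as the transposed matrix. -/
theorem sum_mem_eq_sum_wedgeSign (K : MultiIdx n (p + 1)) (F : Fin n → MultiIdx n p → ℂ) :
    ∑ k : {k // k ∈ K.1}, (-1) ^ ((K.erase k).1.filter (· < k.1)).card * F k.1 (K.erase k) =
      ∑ J, ∑ k, wedgeSign k J K * F k J := by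
  rw [Finset.sum_comm]
  have h : ∀ k : {k // k ∈ K.1},
      (-1) ^ ((K.erase k).1.filter (· < k.1)).card * F k.1 (K.erase k) =
      ∑ J, wedgeSign k.1 J K * F k.1 J := by
    intro k
    rw [Finset.sum_eq_single (K.erase k)]
    · rw [wedgeSign, if_pos]
      exact ⟨Finset.notMem_erase _ _, (Finset.insert_erase k.2).symm⟩
    · intro J _ hJ
      rw [wedgeSign, if_neg, zero_mul]
      rintro ⟨h1, h2⟩
      exact hJ (Subtype.ext (by simp only [MultiIdx.erase, h2, Finset.erase_insert h1]))
    · simp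
  simp_rw [h]
  rw [Finset.sum_coe_sort K.1 fun k => ∑ J, wedgeSign k J K * F k J]
  refine Finset.sum_subset (Finset.subset_univ _) fun k _ hk => Finset.sum_eq_zero fun J _ => ?_
  rw [wedgeSign, if_neg, zero_mul]
  rintro ⟨-, h2⟩
  exact hk (by rw [h2]; exact Finset.mem_insert_self _ _)

/-- `∑_K (dz_k ∧ dz_J)_K (dz_l ∧ dz_J')_K`. -/
theorem sum_wedgeSign_mul_wedgeSign_left (k l : Fin n) (J J' : MultiIdx n p) :
    ∑ K, wedgeSign k J K * wedgeSign l J' K =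
      if k ∉ J.1 ∧ l ∉ J'.1 ∧ insert k J.1 = insert l J'.1 then
        (-1) ^ (J.1.filter (· < k)).card * (-1) ^ (J'.1.filter (· < l)).card else 0 := by
  split_ifs with h
  · rw [Finset.sum_eq_single ⟨insert k J.1, by rw [Finset.card_insert_of_notMem h.1, J.2]⟩]
    · rw [wedgeSign, wedgeSign, if_pos ⟨h.1, rfl⟩, if_pos ⟨h.2.1, h.2.2⟩]
    · intro K _ hK
      rw [wedgeSign, if_neg, zero_mul]
      exact fun h2 => hK (Subtype.ext h2.2)
    · simp
  · refine Finset.sum_eq_zero fun K _ => ?_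
    unfold wedgeSign
    split_ifs with h1 h2
    · exact absurd ⟨h1.1, h2.1, by rw [← h1.2, ← h2.2]⟩ h
    all_goals simp

/-- At most one J contributes, the common value of K \ {k} and K' \ {l}. -/
theorem sum_wedgeSign_mul_wedgeSign_right (k l : Fin n) (K K' : MultiIdx n (p + 1)) :
    ∑ J, wedgeSign k J K * wedgeSign l J K' =
      if k ∈ K.1 ∧ l ∈ K'.1 ∧ K.1.erase k = K'.1.erase l then
        (-1) ^ ((K.1.erase k).filter (· < k)).card * (-1) ^ ((K'.1.erase l).filter (· < l)).card
      else 0 := by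
  split_ifs with h
  · rw [Finset.sum_eq_single (K.erase ⟨k, h.1⟩)]
    · rw [wedgeSign, wedgeSign, if_pos, if_pos]
      · simp only [MultiIdx.erase]
        rw [← h.2.2]
      · simp only [MultiIdx.erase]
        rw [h.2.2]
        exact ⟨Finset.notMem_erase _ _, (Finset.insert_erase h.2.1).symm⟩
      · exact ⟨Finset.notMem_erase _ _, (Finset.insert_erase h.1).symm⟩
    · intro J _ hJ
      rw [wedgeSign, if_neg, zero_mul]
      rintro ⟨h1, h2⟩
      exact hJ (Subtype.ext (by simp only [MultiIdx.erase, h2, Finset.erase_insert h1]))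
    · simp
  · refine Finset.sum_eq_zero fun J _ => ?_
    unfold wedgeSign
    split_ifs with h1 h2
    · refine absurd ⟨?_, ?_, ?_⟩ h
      · rw [h1.2]; exact Finset.mem_insert_self _ _
      · rw [h2.2]; exact Finset.mem_insert_self _ _
      · rw [h1.2, h2.2, Finset.erase_insert h1.1, Finset.erase_insert h2.1]
    all_goals simp

/-- The canonical anticommutation relations between exterior and interior multiplication. -/
theorem sum_wedgeSign_add_sum_wedgeSign (k l : Fin n) (J J' : MultiIdx n (p + 1)) :
    ∑ K, wedgeSign k J K * wedgeSign l J' K + ∑ H, wedgeSign l H J * wedgeSign k H J' =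
      if k = l ∧ J = J' then 1 else 0 := by
  rw [sum_wedgeSign_mul_wedgeSign_left, sum_wedgeSign_mul_wedgeSign_right]
  have hsq : ∀ m : ℕ, (-1 : ℂ) ^ m * (-1) ^ m = 1 := fun m => by
    rw [← mul_pow]; simp
  by_cases hkl : k = l
  · subst hkl
    by_cases hJ : J = J'
    · subst hJ
      by_cases hk : k ∈ J.1 <;> simp [hk, hsq]
    · rw [if_neg, if_neg, if_neg, add_zero]
      · exact fun h => hJ h.2
      · rintro ⟨h1, h2, h3⟩
        exact hJ (Subtype.ext (by rw [← Finset.insert_erase h1, h3, Finset.insert_erase h2]))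
      · rintro ⟨h1, h2, h3⟩
        exact hJ (Subtype.ext (by rw [← Finset.erase_insert h1, h3, Finset.erase_insert h2]))
  · rw [if_neg (c := k = l ∧ J = J') (fun h => hkl h.1)]
    by_cases h : l ∈ J.1 ∧ k ∈ J'.1 ∧ J.1.erase l = J'.1.erase k
    · obtain ⟨hl, hk, hR⟩ := h
      set R := J.1.erase l with hRdef
      have hlR : l ∉ R := Finset.notMem_erase _ _
      have hkR : k ∉ R := by rw [hR]; exact Finset.notMem_erase _ _
      have hJ : J.1 = insert l R := (Finset.insert_erase hl).symm
      have hJ' : J'.1 = insert k R := by rw [hR]; exact (Finset.insert_erase hk).symm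
      rw [if_pos, if_pos ⟨hl, hk, hR⟩, ← hR, hJ, hJ', Finset.filter_insert, Finset.filter_insert]
      -- With J = R ∪ {l} and J' = R ∪ {k}, exactly one of k < l and l < k holds, so the exterior
      -- product of signs has one more factor -1 than the interior one, and they cancel.
      · rcases lt_or_gt_of_ne hkl with hlt | hlt
        · rw [if_neg hlt.not_gt, if_pos hlt, Finset.card_insert_of_notMem
            (fun h => hkR (Finset.mem_filter.1 h).1)]
          ring
        · rw [if_pos hlt, if_neg hlt.not_gt, Finset.card_insert_of_notMem
            (fun h => hlR (Finset.mem_filter.1 h).1)]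
          ring
      · rw [hJ, hJ']
        exact ⟨by simp [hkl, hkR], by simp [Ne.symm hkl, hlR], Finset.insert_comm _ _ _⟩
    · rw [if_neg h, if_neg, add_zero]
      rintro ⟨h1, h2, h3⟩
      have hl : l ∈ J.1 := by
        have : l ∈ insert k J.1 := by rw [h3]; exact Finset.mem_insert_self _ _
        exact (Finset.mem_insert.1 this).resolve_left (Ne.symm hkl)
      have hk : k ∈ J'.1 := by
        have : k ∈ insert l J'.1 := by rw [← h3]; exact Finset.mem_insert_self _ _
        exact (Finset.mem_insert.1 this).resolve_left hkl
      refine h ⟨hl, hk, ?_⟩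
      ext i
      have h4 : i ∈ insert k J.1 ↔ i ∈ insert l J'.1 := by rw [h3]
      simp only [Finset.mem_insert, Finset.mem_erase] at h4 ⊢
      grind

/-- The operator ∑ dz_k∧ ι_k counts the elements of J, each with a squared sign. This is the source
of the form degree in the eigenvalue |α| + p. -/
theorem sum_sum_wedgeSign_mul_wedgeSign (J J' : MultiIdx n (p + 1)) :
    ∑ k, ∑ H, wedgeSign k H J * wedgeSign k H J' = if J = J' then (p + 1 : ℂ) else 0 := by
  simp_rw [sum_wedgeSign_mul_wedgeSign_right]
  have hsq : ∀ m : ℕ, (-1 : ℂ) ^ m * (-1) ^ m = 1 := fun m => by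
    rw [← mul_pow]; simp
  split_ifs with h
  · subst h
    simp only [and_self, hsq, and_true]
    rw [Finset.sum_boole]
    simp [J.2]
  · refine Finset.sum_eq_zero fun k _ => if_neg ?_
    rintro ⟨h1, h2, h3⟩
    exact h (Subtype.ext (by rw [← Finset.insert_erase h1, h3, Finset.insert_erase h2]))

end Wedge

/-! ### Forms and ∂ in terms of coefficients. -/

section Forms

variable {n p : ℕ}

theorem delCoeff_eq_sum (u : FockForm n p) (K : MultiIdx n (p + 1)) :
    delCoeff u K = ∑ J, ∑ k, wedgeSign k J K • dz k (u J).toFun := by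
  ext z
  rw [delCoeff, sum_mem_eq_sum_wedgeSign K fun k J => dz k (u J).toFun z]
  simp [Finset.sum_apply]

theorem taylorCoeff_delCoeff (u : FockForm n p) (K : MultiIdx n (p + 1)) (α : Fin n → ℕ) :
    taylorCoeff n (delCoeff u K) α = ∑ J, ∑ k,
      wedgeSign k J K * ((α k + 1) * taylorCoeff n (u J) (α + Pi.single k 1)) := by
  have h1 : ∀ J k, Differentiable ℂ (wedgeSign k J K • dz k (u J).toFun) := fun J k =>
    (differentiable_dz (u J).mem.1 k).const_smul _
  rw [delCoeff_eq_sum, taylorCoeff_sum _ fun J => Differentiable.sum fun k _ => h1 J k]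
  refine Finset.sum_congr rfl fun J _ => ?_
  rw [taylorCoeff_sum _ fun k => h1 J k]
  refine Finset.sum_congr rfl fun k _ => ?_
  rw [taylorCoeff_const_smul (differentiable_dz (u J).mem.1 k), taylorCoeff_dz (u J).mem.1]

/-- A form all of whose coefficients have order `s`. -/
def FockForm.IsOrder (s : ℕ) (u : FockForm n p) : Prop :=
  ∀ J, FockSpace.MemOrder s (u J).toFun

theorem FockForm.IsOrder.memOrder_delCoeff {s : ℕ} {u : FockForm n p} (hu : u.IsOrder (s + 1))
    (K : MultiIdx n (p + 1)) : FockSpace.MemOrder s (delCoeff u K) := by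
  rw [delCoeff_eq_sum]
  exact .sum _ fun J => .sum _ fun k => .smul _ ((hu J).dz k)

theorem FockForm.IsOrder.mem_domain_del {s : ℕ} {u : FockForm n p} (hu : u.IsOrder (s + 1)) :
    u ∈ (del n p).domain := fun K => (hu.memOrder_delCoeff K).mem

theorem taylorCoeff_del (u : (del n p).domain) (K : MultiIdx n (p + 1)) (α : Fin n → ℕ) :
    taylorCoeff n ((del n p u) K) α = ∑ J, ∑ k,
      wedgeSign k J K * ((α k + 1) * taylorCoeff n (u.1 J) (α + Pi.single k 1)) :=
  taylorCoeff_delCoeff u.1 K α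

theorem FockForm.ext_taylorCoeff {u v : FockForm n p}
    (h : ∀ J α, taylorCoeff n (u J) α = taylorCoeff n (v J) α) : u = v := by
  ext J : 1
  exact Fock.ext_taylorCoeff (h J)

theorem FockForm.hasSum_inner (u v : FockForm n p) :
    HasSum (fun i : MultiIdx n p × (Fin n → ℕ) => (monomialWeight i.2 : ℂ) *
      (conj (taylorCoeff n (u i.1) i.2) * taylorCoeff n (v i.1) i.2)) (inner ℂ u v) := by
  rw [PiLp.inner_apply]
  exact hasSum_prod_of_fintype fun J => Fock.hasSum_inner (u J) (v J)

theorem FockForm.hasSum_norm_sq (u : FockForm n p) :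
    HasSum (fun i : MultiIdx n p × (Fin n → ℕ) =>
      monomialWeight i.2 * ‖taylorCoeff n (u i.1) i.2‖ ^ 2) (‖u‖ ^ 2) := by
  have h := FockForm.hasSum_inner u u
  rw [inner_self_eq_norm_sq_to_K] at h
  simp_rw [Complex.conj_mul'] at h
  exact Complex.hasSum_ofReal.1 (by simpa using h)

theorem FockForm.exists_taylorCoeff {a : MultiIdx n p → (Fin n → ℕ) → ℂ}
    (ha : ∀ J, Summable fun α => monomialWeight α * ‖a J α‖ ^ 2) :
    ∃ u : FockForm n p, ∀ J α, taylorCoeff n (u J) α = a J α := by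
  choose f hf using fun J => Fock.exists_taylorCoeff (ha J)
  exact ⟨WithLp.toLp 2 f, hf⟩

theorem FockForm.taylorCoeff_add (u v : FockForm n p) (J : MultiIdx n p) (α : Fin n → ℕ) :
    taylorCoeff n ((u + v) J) α = taylorCoeff n (u J) α + taylorCoeff n (v J) α :=
  Fock.taylorCoeff_add (u J) (v J) α

theorem FockForm.taylorCoeff_smul (c : ℂ) (u : FockForm n p) (J : MultiIdx n p) (α : Fin n → ℕ) :
    taylorCoeff n ((c • u) J) α = c * taylorCoeff n (u J) α :=
  Fock.taylorCoeff_smul c (u J) α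

theorem FockForm.taylorCoeff_sub (u v : FockForm n p) (J : MultiIdx n p) (α : Fin n → ℕ) :
    taylorCoeff n ((u - v) J) α = taylorCoeff n (u J) α - taylorCoeff n (v J) α :=
  Fock.taylorCoeff_sub (u J) (v J) α

end Forms

/-! ### Degree multipliers, truncation, and ∂* on its full domain. -/

namespace FockForm

open Filter Topology

variable {n p : ℕ}

/-- The form `z ^ α dz_J`. -/
def monomial (J : MultiIdx n p) (α : Fin n → ℕ) : FockForm n p :=
  WithLp.toLp 2 (Pi.single J (Fock.monomial α))

theorem monomial_apply_self (J : MultiIdx n p) (α : Fin n → ℕ) :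
    monomial J α J = Fock.monomial α := by simp [monomial]

theorem monomial_apply_of_ne {J J' : MultiIdx n p} (h : J' ≠ J) (α : Fin n → ℕ) :
    monomial J α J' = 0 := by simp [monomial, h]

theorem isOrder_monomial (J : MultiIdx n p) (α : Fin n → ℕ) (s : ℕ) :
    (monomial J α).IsOrder s := fun J' => by
  by_cases h : J' = J
  · rw [h, monomial_apply_self]; exact Fock.memOrder_monomial α s
  · rw [monomial_apply_of_ne h]; exact FockSpace.MemOrder.zero

theorem inner_monomial_left (J : MultiIdx n p) (α : Fin n → ℕ) (u : FockForm n p) :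
    inner ℂ (monomial J α) u = monomialWeight α * taylorCoeff n (u J) α := by
  rw [PiLp.inner_apply, Finset.sum_eq_single J, monomial_apply_self, Fock.inner_monomial_left]
  · intro J' _ h
    rw [monomial_apply_of_ne h, inner_zero_left]
  · simp

theorem exists_degreeMul {m : ℕ → ℝ} (hm : ∀ d, |m d| ≤ 1) (u : FockForm n p) :
    ∃ v : FockForm n p, ∀ J α, taylorCoeff n (v J) α = m (∑ i, α i) * taylorCoeff n (u J) α := by
  refine exists_taylorCoeff fun J => Summable.of_nonneg_of_le
    (fun α => monomialWeight_mul_nonneg _ _) (fun α => ?_) (Fock.hasSum_norm_sq (u J)).summable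
  have h := hm (∑ i, α i)
  rw [norm_mul, Complex.norm_real, Real.norm_eq_abs]
  have h3 := (monomialWeight_pos α).le
  gcongr
  exact mul_le_of_le_one_left (norm_nonneg _) h

/-- The operator that multiplies forms with homogeneous coefficients of degree `d` by `m d`. -/
def degreeMul (m : ℕ → ℝ) (hm : ∀ d, |m d| ≤ 1) : FockForm n p →L[ℂ] FockForm n p :=
  LinearMap.mkContinuous
    { toFun := fun u => (exists_degreeMul hm u).choose
      map_add' := fun u v => ext_taylorCoeff fun J α => by
        rw [taylorCoeff_add, (exists_degreeMul hm _).choose_spec,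
          (exists_degreeMul hm _).choose_spec, (exists_degreeMul hm _).choose_spec,
          taylorCoeff_add, mul_add]
      map_smul' := fun c u => ext_taylorCoeff fun J α => by
        rw [RingHom.id_apply, taylorCoeff_smul, (exists_degreeMul hm _).choose_spec,
          (exists_degreeMul hm _).choose_spec, taylorCoeff_smul, mul_left_comm] } 1 fun u => by
    rw [one_mul, ← pow_le_pow_iff_left₀ (norm_nonneg _) (norm_nonneg _) two_ne_zero]
    refine hasSum_le (fun i => ?_) (hasSum_norm_sq _) (hasSum_norm_sq u)
    change monomialWeight i.2 * ‖taylorCoeff n ((exists_degreeMul hm u).choose i.1) i.2‖ ^ 2 ≤ _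
    rw [(exists_degreeMul hm u).choose_spec, norm_mul, Complex.norm_real, Real.norm_eq_abs]
    have h3 := (monomialWeight_pos i.2).le
    gcongr
    exact mul_le_of_le_one_left (norm_nonneg _) (hm _)

theorem taylorCoeff_degreeMul {m : ℕ → ℝ} (hm : ∀ d, |m d| ≤ 1) (u : FockForm n p)
    (J : MultiIdx n p) (α : Fin n → ℕ) :
    taylorCoeff n (degreeMul m hm u J) α = m (∑ i, α i) * taylorCoeff n (u J) α :=
  (exists_degreeMul hm u).choose_spec J α

/-- A multiplier with m(d)² of size (d + 1)^(-s) gains s orders. -/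
theorem isOrder_degreeMul {m : ℕ → ℝ} (hm : ∀ d, |m d| ≤ 1) {s : ℕ} {C : ℝ}
    (hC : ∀ d : ℕ, (d + 1 : ℝ) ^ s * m d ^ 2 ≤ C) (u : FockForm n p) :
    (degreeMul m hm u).IsOrder s := by
  refine fun J => ⟨(degreeMul m hm u J).mem.1, Summable.of_nonneg_of_le
    (fun α => mul_nonneg (by positivity) (monomialWeight_mul_nonneg _ _)) (fun α => ?_)
    ((Fock.hasSum_norm_sq (u J)).summable.mul_left C)⟩
  rw [taylorCoeff_degreeMul, norm_mul, Complex.norm_real, mul_pow, Real.norm_eq_abs, sq_abs]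
  calc _ = (((∑ i, α i : ℕ) + 1 : ℝ) ^ s * m (∑ i, α i) ^ 2) *
        (monomialWeight α * ‖taylorCoeff n (u J) α‖ ^ 2) := by ring
    _ ≤ _ := mul_le_mul_of_nonneg_right (hC _) (monomialWeight_mul_nonneg _ _)

theorem abs_ite_le_one (M d : ℕ) : |if d ≤ M then (1 : ℝ) else 0| ≤ 1 := by
  split_ifs <;> simp

/-- The projection to the forms with polynomial coefficients of degree at most `M`. -/
def trunc (M : ℕ) : FockForm n p →L[ℂ] FockForm n p :=
  degreeMul (fun d => if d ≤ M then 1 else 0) (abs_ite_le_one M)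

theorem taylorCoeff_trunc (M : ℕ) (u : FockForm n p) (J : MultiIdx n p) (α : Fin n → ℕ) :
    taylorCoeff n (trunc M u J) α = if ∑ i, α i ≤ M then taylorCoeff n (u J) α else 0 := by
  rw [trunc, taylorCoeff_degreeMul]
  split_ifs <;> simp

theorem isOrder_trunc (M s : ℕ) (u : FockForm n p) : (trunc M u).IsOrder s := by
  refine isOrder_degreeMul _ (C := (M + 1) ^ s) (fun d => ?_) u
  split_ifs with h
  · rw [one_pow, mul_one]
    gcongr
  · simp only [ne_eq, OfNat.ofNat_ne_zero, not_false_eq_true, zero_pow, mul_zero]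
    positivity

theorem hasSum_norm_sq_sub_trunc (M : ℕ) (u : FockForm n p) :
    HasSum (fun i : MultiIdx n p × (Fin n → ℕ) => if ∑ l, i.2 l ≤ M then 0 else
      monomialWeight i.2 * ‖taylorCoeff n (u i.1) i.2‖ ^ 2) (‖u - trunc M u‖ ^ 2) := by
  convert hasSum_norm_sq (u - trunc M u) using 2 with i
  rw [taylorCoeff_sub, taylorCoeff_trunc]
  split_ifs <;> simp

/-- The squared error is a tail of the Parseval series, and tends to 0 by dominated convergence. -/
theorem tendsto_trunc (u : FockForm n p) : Tendsto (fun M => trunc M u) atTop (𝓝 u) := by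
  have h : Tendsto (fun M => ‖u - trunc M u‖ ^ 2) atTop
      (𝓝 (∑' _ : MultiIdx n p × (Fin n → ℕ), 0)) := by
    simp_rw [← (hasSum_norm_sq_sub_trunc _ u).tsum_eq]
    refine tendsto_tsum_of_dominated_convergence (hasSum_norm_sq u).summable (fun i => ?_)
      (Eventually.of_forall fun M i => ?_)
    · refine tendsto_const_nhds.congr' ?_
      filter_upwards [eventually_ge_atTop (∑ l, i.2 l)] with M hM
      rw [if_pos hM]
    · have := monomialWeight_mul_nonneg i.2 (taylorCoeff n (u i.1) i.2)
      split_ifs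
      · simpa using this
      · rw [Real.norm_of_nonneg this]
  rw [tsum_zero] at h
  have h1 := (Real.continuous_sqrt.tendsto _).comp h
  simp only [Function.comp_def, Real.sqrt_sq (norm_nonneg _), Real.sqrt_zero] at h1
  rw [tendsto_iff_norm_sub_tendsto_zero]
  simpa only [norm_sub_rev] using h1

theorem dense_domain_del : Dense ((del n p).domain : Set (FockForm n p)) := fun u =>
  mem_closure_of_tendsto (tendsto_trunc u)
    (Eventually.of_forall fun M => (isOrder_trunc M 1 u).mem_domain_del)

/-- Since ∂ lowers the degree by one, cutting at M afterwards is cutting at M + 1 beforehand. This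
reduces statements on dom ∂ to polynomial coefficients. -/
theorem trunc_del (M : ℕ) (u : (del n p).domain) :
    trunc M (del n p u) = del n p ⟨trunc (M + 1) u.1, (isOrder_trunc (M + 1) 1 u.1).mem_domain_del⟩ := by
  refine ext_taylorCoeff fun K α => ?_
  rw [taylorCoeff_trunc, taylorCoeff_del, taylorCoeff_del]
  simp only [taylorCoeff_trunc, sum_add_single, add_le_add_iff_right]
  split_ifs <;> simp

theorem inner_del_left {x : FockForm n p} (hx : x.IsOrder 1) (y : FockForm n (p + 1)) :
    inner ℂ (del n p ⟨x, hx.mem_domain_del⟩) y = ∑ K, ∑ J, ∑ k,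
      wedgeSign k J K * inner ℂ (Fock.mk _ ((hx J).dz k).mem) (y K) := by
  rw [PiLp.inner_apply]
  refine Finset.sum_congr rfl fun K _ => ?_
  have h : (del n p ⟨x, hx.mem_domain_del⟩) K =
      ∑ J, ∑ k, wedgeSign k J K • Fock.mk _ ((hx J).dz k).mem := by
    let L : Fock n →ₗ[ℂ] (Fin n → ℂ) → ℂ := (fockSubmodule n).subtype
    have hL : Function.Injective L := Subtype.val_injective
    refine hL ?_
    simp only [map_sum, map_smul]
    exact delCoeff_eq_sum x K
  rw [h, sum_inner]
  refine Finset.sum_congr rfl fun J _ => ?_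
  rw [sum_inner]
  refine Finset.sum_congr rfl fun k _ => ?_
  rw [inner_smul_left, conj_wedgeSign]

/-- Forms of order one belong to the domain of `∂*`, and `∂*` lowers the order by one. -/
theorem IsOrder.exists_adj_del {s : ℕ} {y : FockForm n (p + 1)} (hy : y.IsOrder (s + 1)) :
    ∃ h : y ∈ (HilbertComplex.adj (del n p)).domain,
      (HilbertComplex.adj (del n p) ⟨y, h⟩ : FockForm n p).IsOrder s := by
  have hm : ∀ K k, FockSpace.Mem fun z => z k * y K z := fun K k => ((hy K).coord_mul k).mem
  -- The expected value ∑ z_k ι_k y of ∂*y.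
  let w : FockForm n p := WithLp.toLp 2 fun J =>
    ∑ K, ∑ k, wedgeSign k J K • Fock.mk _ (hm K k)
  have hw : w.IsOrder s := by
    intro J
    let L : Fock n →ₗ[ℂ] (Fin n → ℂ) → ℂ := (fockSubmodule n).subtype
    have h1 : (w J).toFun = ∑ K, ∑ k, wedgeSign k J K • fun z => z k * y K z := by
      change L (∑ K, ∑ k, wedgeSign k J K • Fock.mk _ (hm K k)) = _
      simp only [map_sum, map_smul]
      rfl
    rw [h1]
    exact .sum _ fun K => .sum _ fun k => .smul _ ((hy K).coord_mul k)
  have h1 : ∀ (x : FockForm n p) (hx : x.IsOrder 1),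
      inner ℂ (del n p ⟨x, hx.mem_domain_del⟩) y = inner ℂ x w := by
    intro x hx
    rw [inner_del_left hx, PiLp.inner_apply, Finset.sum_comm]
    refine Finset.sum_congr rfl fun J _ => ?_
    simp only [w, inner_sum, inner_smul_right]
    refine Finset.sum_congr rfl fun K _ => Finset.sum_congr rfl fun k _ => ?_
    rw [Fock.inner_dz_left (x J) (y K) k ((hx J).dz k).mem (hm K k)]
  -- For general x in dom ∂ the termwise pairing is unavailable, as the single derivatives may leave
  -- the space; truncation reduces to order 1 and the limit recovers x.
  have h2 : ∀ x : (del n p).domain, inner ℂ (del n p x) y = inner ℂ (x : FockForm n p) w := by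
    intro x
    have h3 : Tendsto (fun M => inner ℂ (trunc M (del n p x)) y) atTop
        (𝓝 (inner ℂ (del n p x) y)) := (tendsto_trunc _).inner tendsto_const_nhds
    have h4 : Tendsto (fun M => inner ℂ (trunc (M + 1) x.1) w) atTop
        (𝓝 (inner ℂ x.1 w)) :=
      ((tendsto_add_atTop_iff_nat 1).2 (tendsto_trunc x.1)).inner tendsto_const_nhds
    refine tendsto_nhds_unique h3 (h4.congr fun M => ?_)
    rw [trunc_del, h1 _ (isOrder_trunc _ _ _)]
  obtain ⟨h, he⟩ := HilbertComplex.exists_adj_eq dense_domain_del h2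
  exact ⟨h, by rw [he]; exact hw⟩

/-- Testing the adjoint relation against z^α dz_J shows that ∂* acts by the formal formula ∑ z_k ι_k
on every element of its domain, with no regularity assumed. -/
theorem taylorCoeff_adj_del (y : (HilbertComplex.adj (del n p)).domain) (J : MultiIdx n p)
    (α : Fin n → ℕ) : taylorCoeff n ((HilbertComplex.adj (del n p) y : FockForm n p) J) α =
      ∑ K, ∑ k, wedgeSign k J K *
        if α k = 0 then 0 else taylorCoeff n (y.1 K) (α - Pi.single k 1) := by
  have hx := isOrder_monomial J α 1
  have h1 := HilbertComplex.inner_adj_right dense_domain_del ⟨_, hx.mem_domain_del⟩ y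
  have h0 : (monomialWeight α : ℂ) ≠ 0 := by exact_mod_cast (monomialWeight_pos α).ne'
  refine mul_left_cancel₀ h0 ?_
  rw [← inner_monomial_left, ← h1, inner_del_left hx, Finset.mul_sum]
  refine Finset.sum_congr rfl fun K _ => ?_
  rw [Finset.sum_eq_single J, Finset.mul_sum]
  · refine Finset.sum_congr rfl fun k _ => ?_
    have h3 : Fock.mk _ ((hx J).dz k).mem =
        Fock.mk _ ((Fock.memOrder_monomial α 1).dz k).mem := by
      refine Fock.ext fun z => ?_
      simp only [Fock.mk_apply, monomial_apply_self]
    rw [h3, Fock.inner_dz_monomial_left]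
    ring
  · intro J' _ h
    refine Finset.sum_eq_zero fun k _ => ?_
    have h3 : Fock.mk _ ((hx J').dz k).mem = 0 := by
      refine Fock.ext fun z => ?_
      have h4 : (0 : Fock n).toFun = fun _ => 0 := rfl
      simp [Fock.mk_apply, monomial_apply_of_ne h, dz, h4]
    rw [h3, inner_zero_left, mul_zero]
  · simp

/-- Counterpart of `trunc_del`: ∂* raises the degree by one. -/
theorem trunc_adj_del (M : ℕ) (y : (HilbertComplex.adj (del n p)).domain) :
    trunc (M + 1) (HilbertComplex.adj (del n p) y : FockForm n p) =
      HilbertComplex.adj (del n p) ⟨trunc M y.1, (isOrder_trunc M 1 y.1).exists_adj_del.1⟩ := by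
  refine ext_taylorCoeff fun J α => ?_
  rw [taylorCoeff_trunc, taylorCoeff_adj_del, taylorCoeff_adj_del]
  have h : ∀ k, α k ≠ 0 → (∑ i, α i ≤ M + 1 ↔ ∑ i, (α - Pi.single k 1 : Fin n → ℕ) i ≤ M) := by
    intro k hk
    conv_lhs => rw [← sub_single_add_single hk, sum_add_single]
    omega
  simp only [taylorCoeff_trunc]
  split_ifs with hd
  · refine Finset.sum_congr rfl fun K _ => Finset.sum_congr rfl fun k _ => ?_
    by_cases hk : α k = 0
    · simp [hk]
    · rw [if_neg hk, if_neg hk, if_pos ((h k hk).1 hd)]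
  · refine (Finset.sum_eq_zero fun K _ => Finset.sum_eq_zero fun k _ => ?_).symm
    by_cases hk : α k = 0
    · simp [hk]
    · rw [if_neg hk, if_neg (fun h' => hd ((h k hk).2 h')), mul_zero]

end FockForm

/-! ### Finite rank of truncations and diagonalization of the Laplacian. -/

namespace FockForm

open Filter Topology HilbertComplex

variable {n p : ℕ}

/-- The truncation is a finite sum of rank-one operators built from the orthogonal monomials z^α
dz_J. -/
theorem isCompactOperator_trunc (M : ℕ) :
    IsCompactOperator (trunc M : FockForm n p →L[ℂ] FockForm n p) := by
  let R : MultiIdx n p × (Fin n → ℕ) → FockForm n p →L[ℂ] FockForm n p := fun i =>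
    (ContinuousLinearMap.toSpanSingleton ℂ
      ((if ∑ l, i.2 l ≤ M then (monomialWeight i.2 : ℂ)⁻¹ else 0) • monomial i.1 i.2)).comp
      (innerSL ℂ (monomial i.1 i.2))
  have hR : ∀ i, IsCompactOperator (R i) := fun i =>
    (isCompactOperator_of_locallyCompactSpace_dom (innerSL ℂ (monomial i.1 i.2))).clm_comp
      (ContinuousLinearMap.toSpanSingleton ℂ
        ((if ∑ l, i.2 l ≤ M then (monomialWeight i.2 : ℂ)⁻¹ else 0) • monomial i.1 i.2))
  -- A box containing all exponents of degree at most M; the condition in R removes the others.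
  let s : Finset (MultiIdx n p × (Fin n → ℕ)) :=
    Finset.univ ×ˢ Fintype.piFinset fun _ => Finset.range (M + 1)
  have h : (trunc M : FockForm n p →L[ℂ] FockForm n p) = ∑ i ∈ s, R i := by
    ext1 u
    refine ext_inner_left ℂ fun v => ?_
    rw [_root_.sum_apply, inner_sum]
    refine (hasSum_inner v (trunc M u)).unique ?_
    convert hasSum_sum_of_ne_finset_zero (s := s) (L := .unconditional _) fun i hi => ?_ using 1
    · refine Finset.sum_congr rfl fun i _ => ?_
      have h0 : (monomialWeight i.2 : ℂ) ≠ 0 := by exact_mod_cast (monomialWeight_pos i.2).ne'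
      simp only [R, ContinuousLinearMap.comp_apply, ContinuousLinearMap.toSpanSingleton_apply,
        innerSL_apply_apply, inner_smul_right, inner_monomial_left, taylorCoeff_trunc]
      rw [← inner_conj_symm v, inner_monomial_left]
      split_ifs
      · simp
        field_simp
      · simp
    · rw [taylorCoeff_trunc, if_neg]
      · simp
      · intro hle
        refine hi (Finset.mem_product.2 ⟨Finset.mem_univ _, Fintype.mem_piFinset.2 fun l => ?_⟩)
        have := Finset.single_le_sum (f := i.2) (fun _ _ => Nat.zero_le _) (Finset.mem_univ l)
        rw [Finset.mem_range]
        omega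
  rw [h]
  exact Submodule.sum_mem (compactOperator (RingHom.id ℂ) (FockForm n p) (FockForm n p))
    fun i _ => hR i

variable {q : ℕ}

theorem fockBox_apply (u : (fockBox n (q + 1)).domain) :
    ∃ (h1 : u.1 ∈ (del n (q + 1)).domain)
      (h2 : del n (q + 1) ⟨u.1, h1⟩ ∈ (adj (del n (q + 1))).domain)
      (h3 : u.1 ∈ (adj (del n q)).domain)
      (h4 : (adj (del n q) ⟨u.1, h3⟩ : FockForm n q) ∈ (del n q).domain),
      fockBox n (q + 1) u = adj (del n (q + 1)) ⟨del n (q + 1) ⟨u.1, h1⟩, h2⟩ +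
        del n q ⟨adj (del n q) ⟨u.1, h3⟩, h4⟩ :=
  ⟨u.2.1.1, u.2.1.2, u.2.2.1, u.2.2.2, rfl⟩

/-- Each of ∂ and ∂* costs one order. -/
theorem IsOrder.mem_domain_fockBox {u : FockForm n (q + 1)} (hu : u.IsOrder 2) :
    u ∈ (fockBox n (q + 1)).domain := by
  have h1 : FockForm.IsOrder 1 (del n (q + 1) ⟨u, hu.mem_domain_del⟩) := hu.memOrder_delCoeff
  obtain ⟨h2, h3⟩ := hu.exists_adj_del
  exact ⟨⟨hu.mem_domain_del, h1.exists_adj_del.1⟩, ⟨h2, h3.mem_domain_del⟩⟩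

/-- The two sums are the coefficients of ∂*∂u and ∂∂*u. Stated for arbitrary families c, the
computation is free of domain questions. Commuting ∂/∂z_l past z_k makes the summands equal up to
δ_kl; the anticommutation relations collapse the sum to ∑ α_k, and the δ_kl terms count the elements
of J. -/
theorem taylorCoeff_fockBox_aux (c : MultiIdx n (q + 1) → (Fin n → ℕ) → ℂ)
    (J : MultiIdx n (q + 1)) (α : Fin n → ℕ) :
    (∑ K, ∑ k, wedgeSign k J K * (if α k = 0 then 0 else ∑ J', ∑ l, wedgeSign l J' K *
      (((α - Pi.single k 1 : Fin n → ℕ) l + 1) * c J' (α - Pi.single k 1 + Pi.single l 1)))) +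
    (∑ H, ∑ l, wedgeSign l H J * ((α l + 1) * ∑ J', ∑ k, wedgeSign k H J' *
      (if (α + Pi.single l 1 : Fin n → ℕ) k = 0 then 0 else
        c J' (α + Pi.single l 1 - Pi.single k 1)))) =
    ((∑ i, α i : ℕ) + (q + 1)) * c J α := by
  -- The coefficient of z^α in z_k ∂u_{J'}/∂z_l; `hB` is then the relation ∂_l z_k = z_k ∂_l + δ_kl.
  let B : Fin n → Fin n → MultiIdx n (q + 1) → ℂ := fun k l J' => if α k = 0 then 0 else
    ((α - Pi.single k 1 : Fin n → ℕ) l + 1) * c J' (α - Pi.single k 1 + Pi.single l 1)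
  have hB : ∀ k l J', (α l + 1 : ℂ) * (if (α + Pi.single l 1 : Fin n → ℕ) k = 0 then 0 else
      c J' (α + Pi.single l 1 - Pi.single k 1)) = B k l J' + if k = l then c J' α else 0 := by
    intro k l J'
    by_cases hkl : k = l
    · subst hkl
      simp only [B, if_true, Pi.add_apply, Pi.single_eq_same, Nat.add_one_ne_zero, if_false,
        add_tsub_cancel_right]
      by_cases hk : α k = 0
      · simp [hk]
      · rw [if_neg hk, sub_single_add_single hk]
        have : (((α - Pi.single k 1 : Fin n → ℕ) k : ℂ) + 1) = α k := by
          have h1 : (α - Pi.single k 1 : Fin n → ℕ) k + 1 = α k := by simp; omega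
          exact_mod_cast h1
        rw [this]
        ring
    · simp only [B, if_neg hkl, add_zero, Pi.add_apply, Pi.single_eq_of_ne hkl]
      split_ifs with hk
      · simp
      · have h1 : (α - Pi.single k 1 : Fin n → ℕ) l = α l := by
          simp [Pi.single_eq_of_ne (Ne.symm hkl)]
        have h2 : α + Pi.single l 1 - Pi.single k 1 = α - Pi.single k 1 + Pi.single l 1 := by
          ext i
          by_cases hi : i = k
          · subst hi; simp [Pi.single_eq_of_ne hkl]
          · simp [Pi.single_eq_of_ne hi]
        rw [h1, h2]
  have hB0 : ∀ k, B k k J = α k * c J α := by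
    intro k
    have h := hB k k J
    simp only [if_true, Pi.add_apply, Pi.single_eq_same, Nat.add_one_ne_zero, if_false,
      add_tsub_cancel_right] at h
    linear_combination -h
  have h1 : ∑ K, ∑ k, wedgeSign k J K * (if α k = 0 then 0 else ∑ J', ∑ l, wedgeSign l J' K *
      (((α - Pi.single k 1 : Fin n → ℕ) l + 1) * c J' (α - Pi.single k 1 + Pi.single l 1))) =
      ∑ k, ∑ l, ∑ J', (∑ K, wedgeSign k J K * wedgeSign l J' K) * B k l J' := by
    simp only [Finset.sum_mul]
    rw [Finset.sum_comm]
    refine Finset.sum_congr rfl fun k _ => ?_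
    have h2 : ∀ K, wedgeSign k J K * (if α k = 0 then 0 else ∑ J', ∑ l, wedgeSign l J' K *
        (((α - Pi.single k 1 : Fin n → ℕ) l + 1) * c J' (α - Pi.single k 1 + Pi.single l 1))) =
        ∑ l, ∑ J', wedgeSign k J K * wedgeSign l J' K * B k l J' := by
      intro K
      rw [Finset.sum_comm]
      simp only [B]
      split_ifs
      · simp
      · simp only [Finset.mul_sum, mul_assoc]
    simp_rw [h2]
    rw [Finset.sum_comm]
    refine Finset.sum_congr rfl fun l _ => ?_
    rw [Finset.sum_comm]
  have h3 : ∑ H, ∑ l, wedgeSign l H J * ((α l + 1) * ∑ J', ∑ k, wedgeSign k H J' *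
      (if (α + Pi.single l 1 : Fin n → ℕ) k = 0 then 0 else
        c J' (α + Pi.single l 1 - Pi.single k 1))) =
      ∑ k, ∑ l, ∑ J', (∑ H, wedgeSign l H J * wedgeSign k H J') *
        (B k l J' + if k = l then c J' α else 0) := by
    simp only [Finset.sum_mul, ← hB]
    have h4 : ∀ (H : MultiIdx n q) (l : Fin n), wedgeSign l H J * ((α l + 1) * ∑ J', ∑ k,
        wedgeSign k H J' * (if (α + Pi.single l 1 : Fin n → ℕ) k = 0 then 0 else
          c J' (α + Pi.single l 1 - Pi.single k 1))) =
        ∑ k, ∑ J', wedgeSign l H J * wedgeSign k H J' * ((α l + 1 : ℂ) *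
          (if (α + Pi.single l 1 : Fin n → ℕ) k = 0 then 0 else
            c J' (α + Pi.single l 1 - Pi.single k 1))) := by
      intro H l
      rw [Finset.sum_comm]
      simp only [Finset.mul_sum]
      refine Finset.sum_congr rfl fun k _ => Finset.sum_congr rfl fun J' _ => ?_
      ring
    simp_rw [h4]
    rw [Finset.sum_comm]
    conv_rhs => rw [Finset.sum_comm]
    refine Finset.sum_congr rfl fun l _ => ?_
    rw [Finset.sum_comm]
    refine Finset.sum_congr rfl fun k _ => ?_
    rw [Finset.sum_comm]
  rw [h1, h3]
  simp only [mul_add, Finset.sum_add_distrib]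
  rw [← add_assoc]
  simp only [← Finset.sum_add_distrib, ← add_mul, sum_wedgeSign_add_sum_wedgeSign]
  simp only [Finset.sum_add_distrib]
  have h5 : ∀ k l : Fin n, ∑ J', (if k = l ∧ J = J' then (1 : ℂ) else 0) * B k l J' =
      if k = l then B k l J else 0 := by
    intro k l
    by_cases hkl : k = l <;> simp [hkl]
  have h6 : ∑ k, ∑ l, ∑ J', (∑ H, wedgeSign l H J * wedgeSign k H J') *
      (if k = l then c J' α else 0) = (q + 1) * c J α := by
    have h7 : ∀ k : Fin n, ∑ l, ∑ J', (∑ H, wedgeSign l H J * wedgeSign k H J') *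
        (if k = l then c J' α else 0) =
        ∑ J', (∑ H, wedgeSign k H J * wedgeSign k H J') * c J' α := by
      intro k
      rw [Finset.sum_eq_single k]
      · simp
      · intro l _ hl
        simp [Ne.symm hl]
      · simp
    simp_rw [h7]
    rw [Finset.sum_comm]
    simp_rw [← Finset.sum_mul, sum_sum_wedgeSign_mul_wedgeSign]
    simp
  rw [h6]
  simp only [h5, Finset.sum_ite_eq, Finset.mem_univ, if_true, hB0]
  rw [← Finset.sum_mul]
  push_cast
  ring

theorem taylorCoeff_fockBox (u : (fockBox n (q + 1)).domain) (J : MultiIdx n (q + 1))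
    (α : Fin n → ℕ) : taylorCoeff n ((fockBox n (q + 1) u) J) α =
      ((∑ i, α i : ℕ) + (q + 1)) * taylorCoeff n (u.1 J) α := by
  obtain ⟨h1, h2, h3, h4, h⟩ := fockBox_apply u
  rw [h, taylorCoeff_add, taylorCoeff_adj_del, taylorCoeff_del,
    ← taylorCoeff_fockBox_aux fun J α => taylorCoeff n (u.1 J) α]
  simp only [taylorCoeff_del, taylorCoeff_adj_del]

end FockForm

/-! ### The graph norm, compactness of ι, and the ∂-Neumann operator. -/

namespace FockForm

open Filter Topology HilbertComplex

variable {n q : ℕ}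

/-- The elements of the domain of the Laplacian, as elements of `dom ∂ ∩ dom ∂*`. -/
def toGraph (u : (fockBox n (q + 1)).domain) : GraphSpace (del n q) (del n (q + 1)) :=
  ⟨u.1, u.2.1.1, u.2.2.1⟩

theorem graph_inner_eq (u v : GraphSpace (del n q) (del n (q + 1))) :
    inner ℂ u v = inner ℂ (del n (q + 1) ⟨u.1, u.2.1⟩) (del n (q + 1) ⟨v.1, v.2.1⟩) +
      inner ℂ (adj (del n q) ⟨u.1, u.2.2⟩ : FockForm n q) (adj (del n q) ⟨v.1, v.2.2⟩) := rfl

/-- The weak formulation Q(u, v) = (□̃u, v), with u in dom □̃ and v only in the form domain. -/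
theorem inner_toGraph_left (u : (fockBox n (q + 1)).domain)
    (v : GraphSpace (del n q) (del n (q + 1))) :
    inner ℂ (toGraph u) v = inner ℂ (fockBox n (q + 1) u) (GraphSpace.incl _ _ v) := by
  obtain ⟨h1, h2, h3, h4, h⟩ := fockBox_apply u
  rw [h, inner_add_left, graph_inner_eq]
  congr 1
  · rw [← inner_conj_symm, ← inner_conj_symm (_ : FockForm n (q + 1)) (GraphSpace.incl _ _ v)]
    exact congrArg _ (inner_adj_right dense_domain_del ⟨v.1, v.2.1⟩ ⟨_, h2⟩)
  · exact (inner_adj_right dense_domain_del ⟨_, h4⟩ ⟨v.1, v.2.2⟩).symm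

/-- Truncation on `dom ∂ ∩ dom ∂*`. -/
def truncGraph (M : ℕ) (v : GraphSpace (del n q) (del n (q + 1))) :
    GraphSpace (del n q) (del n (q + 1)) :=
  toGraph ⟨trunc M (GraphSpace.incl _ _ v), (isOrder_trunc M 2 _).mem_domain_fockBox⟩

/-- Truncating v at M + 1 truncates ∂v at M and ∂*v at M + 2, so both parts of the graph norm
converge. -/
theorem tendsto_inner_truncGraph (v : GraphSpace (del n q) (del n (q + 1))) :
    Tendsto (fun M => inner ℂ (truncGraph (M + 1) v) (truncGraph (M + 1) v)) atTop
      (𝓝 (inner ℂ v v)) := by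
  have h1 : ∀ M, inner ℂ (truncGraph (M + 1) v) (truncGraph (M + 1) v) =
      inner ℂ (trunc M (del n (q + 1) ⟨v.1, v.2.1⟩)) (trunc M (del n (q + 1) ⟨v.1, v.2.1⟩)) +
      inner ℂ (trunc (M + 2) (adj (del n q) ⟨v.1, v.2.2⟩ : FockForm n q))
        (trunc (M + 2) (adj (del n q) ⟨v.1, v.2.2⟩ : FockForm n q)) := by
    intro M
    rw [trunc_del, trunc_adj_del (M + 1)]
    rfl
  simp_rw [h1]
  rw [graph_inner_eq]
  have h2 := tendsto_trunc (del n (q + 1) ⟨v.1, v.2.1⟩)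
  have h3 := (tendsto_add_atTop_iff_nat 2).2
    (tendsto_trunc (adj (del n q) ⟨v.1, v.2.2⟩ : FockForm n q))
  exact (h2.inner h2).add (h3.inner h3)

theorem hasSum_inner_truncGraph (M : ℕ) (v : GraphSpace (del n q) (del n (q + 1))) :
    HasSum (fun i : MultiIdx n (q + 1) × (Fin n → ℕ) => if ∑ l, i.2 l ≤ M then
      ((∑ l, i.2 l : ℕ) + (q + 1) : ℝ) * (monomialWeight i.2 *
        ‖taylorCoeff n (GraphSpace.incl (del n q) (del n (q + 1)) v i.1) i.2‖ ^ 2) else 0)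
      (‖truncGraph M v‖ ^ 2) := by
  have h1 := inner_self_eq_norm_sq_to_K (𝕜 := ℂ) (truncGraph M v)
  have h2 : inner ℂ (truncGraph M v) (truncGraph M v) = inner ℂ (fockBox n (q + 1)
    ⟨trunc M (GraphSpace.incl _ _ v), (isOrder_trunc M 2 _).mem_domain_fockBox⟩)
      (trunc M (GraphSpace.incl _ _ v)) := inner_toGraph_left _ _
  rw [h2] at h1
  have h3 := hasSum_inner (fockBox n (q + 1)
    ⟨trunc M (GraphSpace.incl _ _ v), (isOrder_trunc M 2 _).mem_domain_fockBox⟩)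
      (trunc M (GraphSpace.incl _ _ v))
  rw [h1] at h3
  refine Complex.hasSum_ofReal.1 ?_
  convert h3 using 2 with i
  · rw [taylorCoeff_fockBox, taylorCoeff_trunc]
    split_ifs
    · rw [map_mul, mul_assoc, Complex.conj_mul']
      simp
      ring
    · simp
  · simp

/-- A general v need not lie in dom □̃, but its truncations do, and there Q(v, v) = (□̃v, v) is
diagonal. Their graph norms converge to ‖v‖, which bounds the partial sums and yields summability;
dominated convergence then gives the value. -/
theorem hasSum_graph_norm_sq (v : GraphSpace (del n q) (del n (q + 1))) :
    HasSum (fun i : MultiIdx n (q + 1) × (Fin n → ℕ) =>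
      ((∑ l, i.2 l : ℕ) + (q + 1) : ℝ) * (monomialWeight i.2 *
        ‖taylorCoeff n (GraphSpace.incl (del n q) (del n (q + 1)) v i.1) i.2‖ ^ 2))
      (‖v‖ ^ 2) := by
  set t : MultiIdx n (q + 1) × (Fin n → ℕ) → ℝ := fun i =>
    ((∑ l, i.2 l : ℕ) + (q + 1) : ℝ) * (monomialWeight i.2 *
      ‖taylorCoeff n (GraphSpace.incl (del n q) (del n (q + 1)) v i.1) i.2‖ ^ 2)
  have ht : ∀ i, 0 ≤ t i := fun i =>
    mul_nonneg (by positivity) (monomialWeight_mul_nonneg _ _)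
  have hM : ∀ M, HasSum (fun i => if ∑ l, i.2 l ≤ M then t i else 0) (‖truncGraph M v‖ ^ 2) :=
    fun M => hasSum_inner_truncGraph M v
  have hlim : Tendsto (fun M => ‖truncGraph (M + 1) v‖ ^ 2) atTop (𝓝 (‖v‖ ^ 2)) := by
    have h := (Complex.continuous_re.tendsto _).comp (tendsto_inner_truncGraph v)
    have h1 : ∀ u : GraphSpace (del n q) (del n (q + 1)), (inner ℂ u u).re = ‖u‖ ^ 2 :=
      fun u => (norm_sq_eq_re_inner (𝕜 := ℂ) u).symm
    simpa only [Function.comp_def, h1] using h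
  have hpt : ∀ i, Tendsto (fun M => if ∑ l, i.2 l ≤ M + 1 then t i else 0) atTop (𝓝 (t i)) := by
    intro i
    refine tendsto_const_nhds.congr' ?_
    filter_upwards [eventually_ge_atTop (∑ l, i.2 l)] with M h
    rw [if_pos (by omega)]
  have hs : Summable t := by
    refine summable_of_sum_le ht (c := ‖v‖ ^ 2) fun s => ?_
    refine le_of_tendsto_of_tendsto (tendsto_finsetSum s fun i _ => hpt i) hlim
      (Eventually.of_forall fun M => ?_)
    exact sum_le_hasSum s (fun i _ => by split_ifs <;> simp [ht]) (hM (M + 1))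
  have h2 : Tendsto (fun M => ‖truncGraph (M + 1) v‖ ^ 2) atTop (𝓝 (∑' i, t i)) := by
    simp_rw [← (hM _).tsum_eq]
    refine tendsto_tsum_of_dominated_convergence hs hpt (Eventually.of_forall fun M i => ?_)
    split_ifs
    · rw [Real.norm_of_nonneg (ht i)]
    · simpa using ht i
  rw [tendsto_nhds_unique hlim h2]
  exact hs.hasSum

/-- Finiteness of the graph norm supplies one power of the degree, which is what puts all first
derivatives into the Fock space. -/
theorem isOrder_incl (v : GraphSpace (del n q) (del n (q + 1))) :
    (GraphSpace.incl (del n q) (del n (q + 1)) v).IsOrder 1 := by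
  refine fun J => ⟨(GraphSpace.incl (del n q) (del n (q + 1)) v J).mem.1, ?_⟩
  have h := (hasSum_graph_norm_sq v).summable.comp_injective (Prod.mk_right_injective J)
  refine Summable.of_nonneg_of_le (fun α => mul_nonneg (by positivity)
    (monomialWeight_mul_nonneg _ _)) (fun α => ?_) h
  refine mul_le_mul_of_nonneg_right ?_ (monomialWeight_mul_nonneg _ _)
  have : (0 : ℝ) ≤ q := q.cast_nonneg
  rw [pow_one]
  linarith

/-- The weight |α| + q + 1 splits into ∑ α_k, giving the derivatives, and q + 1, giving the norm of
the form. -/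
theorem graph_norm_sq_eq (v : GraphSpace (del n q) (del n (q + 1))) :
    ‖v‖ ^ 2 = (∑ J, ∑ k, ∫ z, ‖dz k (GraphSpace.incl (del n q) (del n (q + 1)) v J) z‖ ^ 2 *
      FockSpace.weight z) + (q + 1 : ℕ) * ‖GraphSpace.incl (del n q) (del n (q + 1)) v‖ ^ 2 := by
  set u := GraphSpace.incl (del n q) (del n (q + 1)) v
  have h1 : ∀ J, HasSum (fun α => ((∑ l, α l : ℕ) : ℝ) *
      (monomialWeight α * ‖taylorCoeff n (u J) α‖ ^ 2))
      (∑ k, ∫ z, ‖dz k (u J) z‖ ^ 2 * FockSpace.weight z) := by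
    intro J
    have h2 := hasSum_sum (s := Finset.univ) fun k (_ : k ∈ Finset.univ) =>
      (FockSpace.hasSum_norm_sq_dz_iff (u J).mem.1 k _).1
        ((isOrder_incl v J).dz k).mem.hasSum_norm_sq
    simpa only [← Finset.sum_mul, ← Nat.cast_sum] using h2
  have h2 := (hasSum_prod_of_fintype (f := fun i : MultiIdx n (q + 1) × (Fin n → ℕ) =>
    ((∑ l, i.2 l : ℕ) : ℝ) * (monomialWeight i.2 * ‖taylorCoeff n (u i.1) i.2‖ ^ 2)) h1).add
    ((hasSum_norm_sq u).mul_left ((q + 1 : ℕ) : ℝ))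
  refine (hasSum_graph_norm_sq v).unique ?_
  convert h2 using 2 with i
  push_cast
  ring

/-- Positivity of the form degree enters here: the weight |α| + q + 1 is at least 1. -/
theorem norm_incl_le (v : GraphSpace (del n q) (del n (q + 1))) :
    ‖GraphSpace.incl (del n q) (del n (q + 1)) v‖ ≤ ‖v‖ := by
  rw [← pow_le_pow_iff_left₀ (norm_nonneg _) (norm_nonneg _) two_ne_zero]
  refine hasSum_le (fun i => ?_) (hasSum_norm_sq _) (hasSum_graph_norm_sq v)
  refine le_mul_of_one_le_left (monomialWeight_mul_nonneg _ _) ?_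
  have h1 : (0 : ℝ) ≤ (∑ l, i.2 l : ℕ) := Nat.cast_nonneg _
  have h2 : (0 : ℝ) ≤ q := q.cast_nonneg
  linarith

/-- The embedding of `dom ∂ ∩ dom ∂*` as a bounded operator. -/
def inclL (n q : ℕ) : GraphSpace (del n q) (del n (q + 1)) →L[ℂ] FockForm n (q + 1) :=
  (GraphSpace.incl (del n q) (del n (q + 1))).mkContinuous 1 fun v => by
    rw [one_mul]; exact norm_incl_le v

/-- On degrees above M the graph norm carries a weight at least M + 1, so truncation approximates ι
with error at most (M + 1)^(-1/2) in operator norm. -/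
theorem isCompactOperator_inclL : IsCompactOperator (inclL n q) := by
  have hlim : Tendsto (fun M => (trunc M).comp (inclL n q)) atTop (𝓝 (inclL n q)) := by
    refine (tendsto_iff_norm_sub_tendsto_zero
      (E := GraphSpace (del n q) (del n (q + 1)) →L[ℂ] FockForm n (q + 1))).2 ?_
    have h0 : Tendsto (fun M : ℕ => √(1 / ((M : ℝ) + 1))) atTop (𝓝 0) := by
      have := (Real.continuous_sqrt.tendsto _).comp tendsto_one_div_add_atTop_nhds_zero_nat
      simpa [Function.comp_def] using this
    refine squeeze_zero (fun M => norm_nonneg ((trunc M).comp (inclL n q) - inclL n q)) (fun M => ?_) h0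
    refine ContinuousLinearMap.opNorm_le_bound _ (Real.sqrt_nonneg _) fun v => ?_
    rw [← pow_le_pow_iff_left₀ (norm_nonneg _) (by positivity) two_ne_zero, mul_pow,
      Real.sq_sqrt (by positivity), _root_.sub_apply,
      ContinuousLinearMap.comp_apply, norm_sub_rev]
    refine hasSum_le (fun i => ?_) (hasSum_norm_sq_sub_trunc M _)
      ((hasSum_graph_norm_sq v).mul_left (1 / ((M : ℝ) + 1)))
    have hw := monomialWeight_mul_nonneg i.2
      (taylorCoeff n (GraphSpace.incl (del n q) (del n (q + 1)) v i.1) i.2)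
    have h2 : (0 : ℝ) ≤ q := q.cast_nonneg
    split_ifs with h
    · positivity
    · rw [← mul_assoc]
      refine le_mul_of_one_le_left hw ?_
      have h3 : (M + 1 : ℝ) ≤ (∑ l, i.2 l : ℕ) := by exact_mod_cast not_le.1 h
      rw [one_div, inv_mul_eq_div, one_le_div (by positivity)]
      linarith
  exact isCompactOperator_of_tendsto hlim
    (Eventually.of_forall fun M => (isCompactOperator_trunc M).comp_clm (inclL n q))

theorem abs_one_div_le_one (q d : ℕ) : |1 / ((d : ℝ) + (q + 1))| ≤ 1 := by
  rw [abs_of_nonneg (by positivity), div_le_one (by positivity)]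
  have h1 : (0 : ℝ) ≤ d := d.cast_nonneg
  have h2 : (0 : ℝ) ≤ q := q.cast_nonneg
  linarith

/-- The `∂`-Neumann operator. -/
def neumann (n q : ℕ) : FockForm n (q + 1) →L[ℂ] FockForm n (q + 1) :=
  degreeMul (fun d => 1 / (d + (q + 1))) (abs_one_div_le_one q)

theorem taylorCoeff_neumann (u : FockForm n (q + 1)) (J : MultiIdx n (q + 1)) (α : Fin n → ℕ) :
    taylorCoeff n (neumann n q u J) α =
      (1 / ((∑ i, α i : ℕ) + (q + 1)) : ℝ) * taylorCoeff n (u J) α :=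
  taylorCoeff_degreeMul (abs_one_div_le_one q) u J α

/-- Dividing by d + q + 1 ≥ d + 1 gains two orders, enough to land in dom □̃. -/
theorem isOrder_neumann (u : FockForm n (q + 1)) : (neumann n q u).IsOrder 2 := by
  refine isOrder_degreeMul _ (C := 1) (fun d => ?_) u
  have h2 : (0 : ℝ) ≤ q := q.cast_nonneg
  rw [← mul_pow, mul_one_div]
  refine pow_le_one₀ (by positivity) ?_
  rw [div_le_one (by positivity)]
  linarith

theorem fockBox_neumann (u : FockForm n (q + 1)) :
    fockBox n (q + 1) ⟨neumann n q u, (isOrder_neumann u).mem_domain_fockBox⟩ = u := by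
  refine ext_taylorCoeff fun J α => ?_
  rw [taylorCoeff_fockBox, taylorCoeff_neumann]
  have h : ((∑ i, α i : ℕ) + (q + 1) : ℂ) ≠ 0 := by
    have : (∑ i, α i) + (q + 1) ≠ 0 := by omega
    exact_mod_cast this
  push_cast at h ⊢
  field_simp

theorem neumann_fockBox (v : (fockBox n (q + 1)).domain) :
    neumann n q (fockBox n (q + 1) v) = v := by
  refine ext_taylorCoeff fun J α => ?_
  rw [taylorCoeff_neumann, taylorCoeff_fockBox]
  have h : ((∑ i, α i : ℕ) + (q + 1) : ℂ) ≠ 0 := by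
    have : (∑ i, α i) + (q + 1) ≠ 0 := by omega
    exact_mod_cast this
  push_cast at h ⊢
  field_simp

/-- The adjoint of the embedding of `dom ∂ ∩ dom ∂*`. -/
def inclAdjoint (n q : ℕ) : FockForm n (q + 1) →L[ℂ] GraphSpace (del n q) (del n (q + 1)) :=
  LinearMap.mkContinuous
    -- The weak formulation with □̃Ñu = u says Q(Ñu, v) = (u, v), so Ñ itself is the adjoint once
    -- its values are viewed in the graph space.
    { toFun := fun u => toGraph ⟨neumann n q u, (isOrder_neumann u).mem_domain_fockBox⟩
      map_add' := fun u v => Subtype.ext (map_add (neumann n q) u v)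
      map_smul' := fun c u => Subtype.ext (map_smul (neumann n q) c u) } 1 fun u => by
    set w : GraphSpace (del n q) (del n (q + 1)) :=
      toGraph ⟨neumann n q u, (isOrder_neumann u).mem_domain_fockBox⟩
    change ‖w‖ ≤ 1 * ‖u‖
    have h1 : inner ℂ w w = inner ℂ u (GraphSpace.incl _ _ w) := by
      rw [inner_toGraph_left, fockBox_neumann]
    have h2 : ‖w‖ ^ 2 ≤ ‖u‖ * ‖w‖ := by
      rw [norm_sq_eq_re_inner (𝕜 := ℂ) w, h1]
      refine (RCLike.re_le_norm _).trans ((norm_inner_le_norm _ _).trans ?_)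
      exact mul_le_mul_of_nonneg_left (norm_incl_le w) (norm_nonneg _)
    rw [one_mul]
    nlinarith [norm_nonneg w, norm_nonneg u]

theorem inner_inclAdjoint_left (u : FockForm n (q + 1))
    (v : GraphSpace (del n q) (del n (q + 1))) :
    inner ℂ (inclAdjoint n q u) v = inner ℂ u (GraphSpace.incl _ _ v) := by
  have h := inner_toGraph_left ⟨neumann n q u, (isOrder_neumann u).mem_domain_fockBox⟩ v
  rw [fockBox_neumann] at h
  exact h

/-- Ñ = ι ∘ ι* with ι compact and ι* bounded. -/
theorem isCompactOperator_neumann : IsCompactOperator (neumann n q) :=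
  isCompactOperator_inclL.comp_clm (inclAdjoint n q)

end FockForm

end

theorem mainTheorem2 (n p : ℕ) (hp : 1 ≤ p) (hpn : p ≤ n) :
    ∃ N : FockForm n p →L[ℂ] FockForm n p,
      -- `N` is the inverse of the complex Laplacian, and it is compact
      IsBoundedInverse (fockBox n p) N ∧
      IsCompactOperator N ∧
      -- the graph norm on the intersection of the domains
      (∀ v : FockGraphSpace n p,
        (∀ (J : MultiIdx n p) (k : Fin n), FockSpace.Mem (dz k (fockIncl n p v J))) ∧
        ‖v‖ ^ 2 = (∑ J : MultiIdx n p, ∑ k : Fin n,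
            ∫ z, ‖dz k (fockIncl n p v J) z‖ ^ 2 * FockSpace.weight z)
          + p * ‖fockIncl n p v‖ ^ 2) ∧
      -- the embedding is compact, and `N` is its composition with its adjoint
      IsCompactOperator (fockIncl n p) ∧
      ∃ ιadj : FockForm n p →L[ℂ] FockGraphSpace n p,
        (∀ (u : FockForm n p) (v : FockGraphSpace n p),
          inner ℂ (ιadj u) v = inner ℂ u (fockIncl n p v)) ∧
        ∀ u : FockForm n p, N u = fockIncl n p (ιadj u) := by
  -- Writing p = q + 1 lets `delPrev` reduce to `del n q`.
  obtain ⟨q, rfl⟩ := Nat.exists_eq_add_of_le' hp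
  exact ⟨FockForm.neumann n q,
    ⟨fun u => ⟨_, FockForm.fockBox_neumann u⟩, FockForm.neumann_fockBox⟩,
    FockForm.isCompactOperator_neumann,
    fun v => ⟨fun J k => ((FockForm.isOrder_incl v J).dz k).mem, FockForm.graph_norm_sq_eq v⟩,
    FockForm.isCompactOperator_inclL,
    FockForm.inclAdjoint n q, FockForm.inner_inclAdjoint_left, fun _ => rfl⟩
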